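/- Let $\mathcal H$ be a complex Hilbert space, let $q\in\mathbb C$ with $|q|=1$, and let $T_1,T_2$ be contractions on $\mathcal H$ with $T_1T_2=qT_2T_1$. Put $T=T_1T_2$. **Notation.** Let $D_{T^*}=(I-TT^*)^{1/2}$ and $\mathcal D_{T^*}=\overline{\operatorname{Ran}}\,D_{T^*}$. For a Hilbert space $\mathcal E$, $H^2(\mathcal E)$ is the Hardy space of functions $f(z)=\sum_{n\ge0}z^na_n$ on the unit disc with $a_n\in\mathcal E$ and $\|f\|^2=\sum\|a_n\|^2<\infty$; on it $(M_zf)(z)=zf(z)$, $(R_wf)(z)=f(wz)$ for $|w|=1$, and $(M_{A+zB}f)(z)=(A+zB)f(z)$ for bounded operators $A,B$ on $\mathcal E$. Let $Q_{T^*}$ be the positive square root of the strong limit of $T^nT^{*n}$, and let $X^*,X_1^*,X_2^*$ be the operators on $\overline{\operatorname{Ran}}\,Q_{T^*}$ with $X^*Q_{T^*}h=Q_{T^*}T^*h$ and $X_j^*Q_{T^*}h=Q_{T^*}T_j^*h$ for $h\in\mathcal H$; $X^*$ is an isometry. Let $W_D^*$, acting on $\mathcal Q_{T^*}\supseteq\overline{\operatorname{Ran}}\,Q_{T^*}$,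 be a minimal unitary extension of $X^*$, i.e. $W_D$ is unitary, $W_D^*$ extends $X^*$, and $\mathcal Q_{T^*}=\bigvee_{n\ge0}W_D^n\overline{\operatorname{Ran}}\,Q_{T^*}$. Let $(W_1,W_2)$ be the canonical $q$-commuting unitary pair, i.e. the unique pair of unitaries on $\mathcal Q_{T^*}$ with $W_1W_2=qW_2W_1=W_D$ such that $W_j^*$ extends $X_j^*$ for $j=1,2$. Let $(G_1,G_2)$ be the fundamental operators of $(T_1^*,T_2^*)$, i.e. the unique pair of bounded operators on $\mathcal D_{T^*}$ with $$D_{T^*}G_1D_{T^*}=T_1^*-T_2T^*,\qquad D_{T^*}G_2D_{T^*}=T_2^*-qT_1T^*.$$ On $\mathcal K_D=H^2(\mathcal D_{T^*})\oplus\mathcal Q_{T^*}$ put $$\mathbb W_1^D=M_{G_1^*+zG_2}R_q\oplus W_1,\qquad \mathbb W_2^D=R_{\bar q}M_{G_2^*+zG_1}\oplus W_2,\qquad V_D=M_z\oplus W_D,$$ and let $\Pi_D:\mathcal H\to\mathcal K_D$ be $\Pi_Dh=\big(\sum_{n\ge0}z^nD_{T^*}T^{*n}h\big)\oplus Q_{T^*}h$.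 **Definition.** For a Hilbert space $\mathcal K$, bounded operators $\mathbb W_1,\mathbb W_2,\mathbb W$ on $\mathcal K$ and $\Pi:\mathcal H\to\mathcal K$, the tuple $(\Pi,\mathbb W_1,\mathbb W_2,\mathbb W)$ is a *pseudo $q$-commuting contractive lift* of $(T_1,T_2)$ if $\mathbb W_1,\mathbb W_2$ are contractions; $\mathbb W$ is an isometry; $\mathbb W_1\mathbb W=q\mathbb W\mathbb W_1$; $\mathbb W_2\mathbb W=\bar q\,\mathbb W\mathbb W_2$; $\mathbb W_1=\bar q\,\mathbb W_2^*\mathbb W$; $\Pi$ is a linear isometry with $\Pi T_1^*=\mathbb W_1^*\Pi$, $\Pi T_2^*=\mathbb W_2^*\Pi$ and $\Pi T_2^*T_1^*=\mathbb W^*\Pi$; and $\mathcal K=\bigvee_{n\ge0}\mathbb W^n\operatorname{Ran}\Pi$. **Theorem.** $(\Pi_D,\mathbb W_1^D,\mathbb W_2^D,V_D)$ is a pseudo $q$-commuting contractive lift of $(T_1,T_2)$. Moreover, if $\mathbb W_1,\mathbb W_2$ are bounded operators on $\mathcal K_D$ such that $(\Pi_D,\mathbb W_1,\mathbb W_2,V_D)$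 is a pseudo $q$-commuting contractive lift of $(T_1,T_2)$, then $\mathbb W_1=\mathbb W_1^D$ and $\mathbb W_2=\mathbb W_2^D$. -/

import Mathlib

open Filter Topology ContinuousLinearMap
open scoped InnerProduct

set_option linter.unusedSectionVars false

noncomputable section

namespace TwistedPair

/-! ### The vector-valued Hardy space -/

section Hardy

variable {E F : Type*} [NormedAddCommGroup E] [InnerProductSpace ℂ E]
  [NormedAddCommGroup F] [InnerProductSpace ℂ F]

/-- The Hardy space `H²(E)` of the unit disc: power series `f(z) = ∑ zⁿ aₙ` with coefficients
`aₙ ∈ E` and `‖f‖² = ∑ ‖aₙ‖² < ∞`. An element is stored through its coefficient sequence; its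
value at a point of the disc is `Hardy.eval`. -/
abbrev Hardy (E : Type*) [NormedAddCommGroup E] : Type _ := lp (fun _ : ℕ => E) 2

namespace Hardy

/-- The value `f(z) = ∑ zⁿ aₙ` (a convergent series when `‖z‖ < 1`). -/
def eval (f : Hardy E) (z : ℂ) : E := ∑' n : ℕ, z ^ n • f n

theorem memlp_iff {f : ℕ → E} :
    Memℓp f 2 ↔ Summable fun n => ‖f n‖ ^ 2 := by
  rw [memℓp_gen_iff (by norm_num)]
  simp

theorem summable_sq (f : Hardy E) : Summable fun n => ‖f n‖ ^ 2 :=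
  memlp_iff.1 (lp.memℓp f)

theorem norm_sq (f : Hardy E) : ‖f‖ ^ 2 = ∑' n, ‖f n‖ ^ 2 := by
  have h := lp.norm_rpow_eq_tsum (p := 2) (by norm_num) f
  simpa using h

theorem summable_eval [CompleteSpace E] (f : Hardy E) {z : ℂ} (hz : ‖z‖ < 1) :
    Summable fun n : ℕ => z ^ n • f n := by
  refine Summable.of_norm_bounded
    (g := fun n => ‖z‖ ^ n * ‖f‖) ((summable_geometric_of_lt_one (norm_nonneg z) hz).mul_right _) ?_
  intro n
  rw [norm_smul, norm_pow]
  gcongr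
  exact lp.norm_apply_le_norm (by norm_num) f n

/-- The operator acting on the `n`-th coefficient by `A n`, for uniformly bounded `A n`. -/
def diag (A : ℕ → E →L[ℂ] F) (C : ℝ) (hC : ∀ n, ‖A n‖ ≤ C) : Hardy E →L[ℂ] Hardy F :=
  have hb : ∀ (f : Hardy E) n, ‖A n (f n)‖ ^ 2 ≤ C ^ 2 * ‖f n‖ ^ 2 := fun f n => by
    rw [← mul_pow]
    gcongr
    exact (A n).le_of_opNorm_le (hC n) _
  have hs : ∀ f : Hardy E, Summable fun n => ‖A n (f n)‖ ^ 2 := fun f =>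
    Summable.of_nonneg_of_le (fun _ => by positivity) (hb f) ((summable_sq f).mul_left _)
  LinearMap.mkContinuous
    { toFun := fun f => ⟨fun n => A n (f n), memlp_iff.2 (hs f)⟩
      map_add' := fun f g => by ext n; exact (A n).map_add _ _
      map_smul' := fun c f => by ext n; exact (A n).map_smul _ _ }
    C
    (fun f => by
      have h0 : 0 ≤ C := (norm_nonneg _).trans (hC 0)
      refine le_of_sq_le_sq ?_ (by positivity)
      rw [norm_sq, mul_pow, norm_sq f, ← tsum_mul_left]
      exact (hs f).tsum_le_tsum (hb f) ((summable_sq f).mul_left _))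

@[simp] theorem diag_apply (A : ℕ → E →L[ℂ] F) (C : ℝ) (hC : ∀ n, ‖A n‖ ≤ C) (f : Hardy E)
    (n : ℕ) : diag A C hC f n = A n (f n) := rfl

/-- The coefficientwise action `I ⊗ A` of `A` on `H²(E)`: `(I ⊗ A) f (z) = A (f(z))`. -/
def ampl (A : E →L[ℂ] F) : Hardy E →L[ℂ] Hardy F := diag (fun _ => A) ‖A‖ (fun _ => le_rfl)

/-- The rotation operator `(R_w f)(z) = f(w z)`, for unimodular `w`. -/
def rot (w : Circle) : Hardy E →L[ℂ] Hardy E :=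
  diag (fun n => ((w : ℂ) ^ n) • ContinuousLinearMap.id ℂ E) 1 (fun n => by
    rw [norm_smul, norm_pow, Circle.norm_coe, one_pow, one_mul]
    exact ContinuousLinearMap.norm_id_le)

@[simp] theorem ampl_apply (A : E →L[ℂ] F) (f : Hardy E) (n : ℕ) : ampl A f n = A (f n) := rfl

@[simp] theorem rot_apply (w : Circle) (f : Hardy E) (n : ℕ) :
    rot w f n = (w : ℂ) ^ n • f n := rfl

/-- The shift operator `(M_z f)(z) = z f(z)`. -/
def shift : Hardy E →L[ℂ] Hardy E :=
  let s : (ℕ → E) → ℕ → E := fun f n => Nat.casesOn n 0 f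
  have hs : ∀ f : Hardy E, Summable fun n => ‖s f n‖ ^ 2 := fun f =>
    (summable_nat_add_iff 1).1 (summable_sq f)
  LinearMap.mkContinuous
    { toFun := fun f => ⟨s f, memlp_iff.2 (hs f)⟩
      map_add' := fun f g => by ext n; cases n; exacts [(add_zero _).symm, rfl]
      map_smul' := fun c f => by ext n; cases n; exacts [(smul_zero _).symm, rfl] }
    1
    (fun f => by
      refine le_of_sq_le_sq ?_ (by positivity)
      rw [one_mul, norm_sq, norm_sq f]
      change ∑' n, ‖s f n‖ ^ 2 ≤ _
      rw [(hs f).tsum_eq_zero_add]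
      simp [s])

@[simp] theorem shift_zero (f : Hardy E) : shift f 0 = 0 := rfl

@[simp] theorem shift_succ (f : Hardy E) (n : ℕ) : shift f (n + 1) = f n := rfl

/-- The backward shift `(a₀, a₁, …) ↦ (a₁, a₂, …)`. -/
def backShift : Hardy E →L[ℂ] Hardy E :=
  have hs : ∀ f : Hardy E, Summable fun n => ‖f (n + 1)‖ ^ 2 := fun f =>
    (summable_nat_add_iff 1).2 (summable_sq f)
  LinearMap.mkContinuous
    { toFun := fun f => ⟨fun n => f (n + 1), memlp_iff.2 (hs f)⟩
      map_add' := fun f g => by ext n; rfl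
      map_smul' := fun c f => by ext n; rfl }
    1
    (fun f => by
      refine le_of_sq_le_sq ?_ (by positivity)
      rw [one_mul, norm_sq, norm_sq f, (summable_sq f).tsum_eq_zero_add]
      exact le_add_of_nonneg_left (by positivity))

@[simp] theorem backShift_apply (f : Hardy E) (n : ℕ) : backShift f n = f (n + 1) := rfl

/-- The multiplication operator `(M_{A + zB} f)(z) = (A + z B) f(z)` by a linear pencil. -/
def mulPencil (A B : E →L[ℂ] F) : Hardy E →L[ℂ] Hardy F := ampl A + shift ∘L ampl B

theorem eval_rot (w : Circle) (f : Hardy E) (z : ℂ) : eval (rot w f) z = eval f (w * z) := by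
  simp [eval, smul_smul, mul_pow, mul_comm]

theorem eval_shift [CompleteSpace E] (f : Hardy E) {z : ℂ} (hz : ‖z‖ < 1) :
    eval (shift f) z = z • eval f z := by
  rw [eval, (summable_eval _ hz).tsum_eq_zero_add, eval, ← (summable_eval f hz).tsum_const_smul]
  simp [pow_succ', smul_smul]

theorem eval_ampl [CompleteSpace E] (A : E →L[ℂ] F) (f : Hardy E) {z : ℂ} (hz : ‖z‖ < 1) :
    eval (ampl A f) z = A (eval f z) := by
  rw [eval, eval, A.map_tsum (summable_eval f hz)]
  simp

theorem eval_mulPencil [CompleteSpace E] [CompleteSpace F] (A B : E →L[ℂ] F) (f : Hardy E) {z : ℂ}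
    (hz : ‖z‖ < 1) : eval (mulPencil A B f) z = (A + z • B) (eval f z) := by
  have h : eval (ampl A f + shift (ampl B f)) z =
      eval (ampl A f) z + eval (shift (ampl B f)) z := by
    simp only [eval, lp.coeFn_add, Pi.add_apply, smul_add]
    exact (summable_eval _ hz).tsum_add (summable_eval _ hz)
  simpa [mulPencil, eval_ampl, eval_shift, hz] using h

end Hardy

end Hardy

/-! ### Defect operators and the observability operator -/

section Single

variable {H : Type*} [NormedAddCommGroup H] [InnerProductSpace ℂ H] [CompleteSpace H]

/-- The closure of the range of an operator. -/
abbrev closedRange {K : Type*} [NormedAddCommGroup K] [InnerProductSpace ℂ K] (A : H →L[ℂ] K) :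
    Submodule ℂ K := A.range.topologicalClosure

/-- An operator, viewed as an operator into the closure of its range. -/
def toClosedRange (A : H →L[ℂ] H) : H →L[ℂ] closedRange A :=
  A.codRestrict (closedRange A) (fun x => A.range.le_topologicalClosure ⟨x, rfl⟩)

@[simp] theorem coe_toClosedRange (A : H →L[ℂ] H) (x : H) : (toClosedRange A x : H) = A x := rfl

theorem denseRange_toClosedRange (A : H →L[ℂ] H) : DenseRange (toClosedRange A) := by
  intro x
  rw [Metric.mem_closure_range_iff]
  intro ε hε
  have hx : (x : H) ∈ closure (A.range : Set H) := x.2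
  obtain ⟨_, ⟨y, rfl⟩, hy⟩ := Metric.mem_closure_iff.1 hx ε hε
  exact ⟨y, hy⟩

/-- The operator on `closedRange A` with `A x ↦ A (B x)` (extended by continuity),
which exists when `‖A (B x)‖ ≤ c ‖A x‖`. -/
def pushforward (A B : H →L[ℂ] H) : closedRange A →L[ℂ] closedRange A :=
  ((toClosedRange A ∘L B : H →L[ℂ] closedRange A) : H →ₗ[ℂ] closedRange A).extendOfNorm
    (toClosedRange A : H →ₗ[ℂ] closedRange A)

theorem pushforward_apply {A B : H →L[ℂ] H} (h : ∀ x, ‖A (B x)‖ ≤ ‖A x‖) (x : H) :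
    pushforward A B (toClosedRange A x) = toClosedRange A (B x) :=
  LinearMap.extendOfNorm_eq (f := ((toClosedRange A ∘L B : H →L[ℂ] closedRange A) :
    H →ₗ[ℂ] closedRange A)) (e := (toClosedRange A : H →ₗ[ℂ] closedRange A))
    (denseRange_toClosedRange A) ⟨1, fun x => by simpa using h x⟩ x

/-- The defect operator `D_T = (I - T* T)^{1/2}` of a contraction. -/
def defectOp (T : H →L[ℂ] H) : H →L[ℂ] H := CFC.sqrt (1 - T† * T)

/-- The defect space, the closure of the range of the defect operator. -/
abbrev DefectSpace (T : H →L[ℂ] H) : Submodule ℂ H := closedRange (defectOp T)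

theorem isSelfAdjoint_defectOp (T : H →L[ℂ] H) : (defectOp T)† = defectOp T :=
  (CFC.sqrt_nonneg (1 - T† * T)).isSelfAdjoint

theorem nonneg_of_inner {A : H →L[ℂ] H} (r : H → ℝ) (hr : ∀ x, 0 ≤ r x)
    (h : ∀ x, inner ℂ (A x) x = (r x : ℂ)) : 0 ≤ A := by
  rw [ContinuousLinearMap.nonneg_iff_isPositive, ContinuousLinearMap.isPositive_iff_complex]
  intro x
  rw [h x]
  simp [hr x]

theorem inner_adjoint_mul_self (A : H →L[ℂ] H) (x : H) :
    inner ℂ ((A† * A) x) x = ((‖A x‖ ^ 2 : ℝ) : ℂ) := by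
  rw [mul_apply_eq_comp, ContinuousLinearMap.adjoint_inner_left,
    inner_self_eq_norm_sq_to_K]
  simp

theorem inner_one_sub (A : H →L[ℂ] H) (x : H) :
    inner ℂ ((1 - A† * A) x) x = ((‖x‖ ^ 2 - ‖A x‖ ^ 2 : ℝ) : ℂ) := by
  rw [sub_apply, inner_sub_left, inner_adjoint_mul_self,
    one_apply_eq_self, inner_self_eq_norm_sq_to_K]
  simp

theorem norm_apply_le_of_contraction {T : H →L[ℂ] H} (hT : ‖T‖ ≤ 1) (x : H) : ‖T x‖ ≤ ‖x‖ := by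
  simpa using T.le_of_opNorm_le hT x

theorem norm_adjoint_le_one {T : H →L[ℂ] H} (hT : ‖T‖ ≤ 1) : ‖T†‖ ≤ 1 := by
  rwa [LinearIsometryEquiv.norm_map]

theorem defectOp_mul_self {T : H →L[ℂ] H} (hT : ‖T‖ ≤ 1) :
    defectOp T * defectOp T = 1 - T† * T := by
  refine CFC.sqrt_mul_sqrt_self _ (nonneg_of_inner _ (fun x => ?_) (inner_one_sub T))
  have := norm_apply_le_of_contraction hT x
  have := pow_le_pow_left₀ (norm_nonneg _) this 2
  linarith

theorem norm_defectOp_sq {T : H →L[ℂ] H} (hT : ‖T‖ ≤ 1) (x : H) :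
    ‖defectOp T x‖ ^ 2 = ‖x‖ ^ 2 - ‖T x‖ ^ 2 := by
  have h := inner_adjoint_mul_self (defectOp T) x
  rw [isSelfAdjoint_defectOp, defectOp_mul_self hT, inner_one_sub] at h
  exact_mod_cast h.symm

theorem sum_norm_defectOp_sq {T : H →L[ℂ] H} (hT : ‖T‖ ≤ 1) (x : H) (n : ℕ) :
    ∑ k ∈ Finset.range n, ‖defectOp T ((T ^ k) x)‖ ^ 2 = ‖x‖ ^ 2 - ‖(T ^ n) x‖ ^ 2 := by
  induction n with
  | zero => simp
  | succ n ih =>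
    rw [Finset.sum_range_succ, ih, norm_defectOp_sq hT, pow_succ' T n,
      mul_apply_eq_comp]
    ring

theorem summable_defectOp {T : H →L[ℂ] H} (hT : ‖T‖ ≤ 1) (x : H) :
    Summable fun k => ‖defectOp T ((T ^ k) x)‖ ^ 2 :=
  summable_of_sum_range_le (c := ‖x‖ ^ 2) (fun _ => by positivity) (fun n => by
    rw [sum_norm_defectOp_sq hT]
    exact sub_le_self _ (by positivity))

/-- The observability operator `𝒪 h = ∑ zⁿ D_T Tⁿ h`, from `H` to `H²(𝒟_T)`. -/
def observability {T : H →L[ℂ] H} (hT : ‖T‖ ≤ 1) : H →L[ℂ] Hardy (DefectSpace T) :=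
  LinearMap.mkContinuous
    { toFun := fun x => ⟨fun n => toClosedRange (defectOp T) ((T ^ n) x),
        Hardy.memlp_iff.2 (summable_defectOp hT x)⟩
      map_add' := fun x y => by
        ext n
        exact congrArg Subtype.val ((toClosedRange (defectOp T) ∘L (T ^ n)).map_add x y)
      map_smul' := fun c x => by
        ext n
        exact congrArg Subtype.val ((toClosedRange (defectOp T) ∘L (T ^ n)).map_smul c x) }
    1
    (fun x => by
      refine le_of_sq_le_sq ?_ (by positivity)
      rw [one_mul, Hardy.norm_sq]
      refine (summable_defectOp hT x).tsum_le_of_sum_range_le (fun n => ?_)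
      rw [sum_norm_defectOp_sq hT]
      exact sub_le_self _ (by positivity))

@[simp] theorem observability_apply {T : H →L[ℂ] H} (hT : ‖T‖ ≤ 1) (x : H) (n : ℕ) :
    observability hT x n = toClosedRange (defectOp T) ((T ^ n) x) := rfl

/-! ### The asymptotic limit -/

theorem observability_adjoint_single {T : H →L[ℂ] H} (hT : ‖T‖ ≤ 1) (n : ℕ)
    (y : DefectSpace T) :
    ((observability hT)†) (lp.single 2 n y) = ((T†) ^ n) (defectOp T y) := by
  refine ext_inner_right ℂ fun x => ?_
  have h1 : ((T†) ^ n : H →L[ℂ] H) = (T ^ n)† := (star_pow T n).symm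
  rw [ContinuousLinearMap.adjoint_inner_left, lp.inner_single_left, h1,
    ContinuousLinearMap.adjoint_inner_left, observability_apply, Submodule.coe_inner,
    coe_toClosedRange]
  nth_rw 2 [← isSelfAdjoint_defectOp T]
  rw [ContinuousLinearMap.adjoint_inner_left]

/-- For a contraction `T` the sequence `(T*)ⁿ Tⁿ` converges in the strong operator topology. -/
theorem exists_asymptoticLimit {T : H →L[ℂ] H} (hT : ‖T‖ ≤ 1) :
    ∃ L : H →L[ℂ] H, ∀ x, Tendsto (fun n : ℕ => ((T†) ^ n) ((T ^ n) x)) atTop (𝓝 (L x)) := by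
  refine ⟨1 - (observability hT)† ∘L observability hT, fun x => ?_⟩
  have h1 := (lp.hasSum_single (p := 2) (by norm_num) (observability hT x)).tendsto_sum_nat
  have h2 := (((observability hT)†).continuous.tendsto _).comp h1
  refine (h2.const_sub x).congr fun n => ?_
  simp only [Function.comp_apply, map_sum, observability_adjoint_single, observability_apply,
    coe_toClosedRange]
  induction n with
  | zero => simp
  | succ n ih =>
    have h3 := congrArg (fun A : H →L[ℂ] H => ((T†) ^ n) (A ((T ^ n) x))) (defectOp_mul_self hT)
    simp only [mul_apply_eq_comp, sub_apply,
      one_apply_eq_self, map_sub] at h3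
    rw [Finset.sum_range_succ, ← sub_sub, ih, h3, pow_succ (T†) n, pow_succ' T n,
      mul_apply_eq_comp, mul_apply_eq_comp, sub_sub_cancel]

/-- The strong limit of `(T*)ⁿ Tⁿ`. -/
def asymptoticLimit {T : H →L[ℂ] H} (hT : ‖T‖ ≤ 1) : H →L[ℂ] H :=
  (exists_asymptoticLimit hT).choose

theorem tendsto_asymptoticLimit {T : H →L[ℂ] H} (hT : ‖T‖ ≤ 1) (x : H) :
    Tendsto (fun n : ℕ => ((T†) ^ n) ((T ^ n) x)) atTop (𝓝 (asymptoticLimit hT x)) :=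
  (exists_asymptoticLimit hT).choose_spec x

/-- `Q_T`, the positive square root of the strong limit of `(T*)ⁿ Tⁿ`. -/
def asymptoticRoot {T : H →L[ℂ] H} (hT : ‖T‖ ≤ 1) : H →L[ℂ] H := CFC.sqrt (asymptoticLimit hT)

theorem tendsto_inner_asymptoticLimit {T : H →L[ℂ] H} (hT : ‖T‖ ≤ 1) (x : H) :
    Tendsto (fun n : ℕ => ((‖(T ^ n) x‖ ^ 2 : ℝ) : ℂ)) atTop
      (𝓝 (inner ℂ (asymptoticLimit hT x) x)) := by
  refine ((tendsto_asymptoticLimit hT x).inner tendsto_const_nhds).congr fun n => ?_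
  have h1 : ((T†) ^ n : H →L[ℂ] H) = (T ^ n)† := (star_pow T n).symm
  rw [h1, ← inner_adjoint_mul_self, mul_apply_eq_comp]

theorem asymptoticLimit_nonneg {T : H →L[ℂ] H} (hT : ‖T‖ ≤ 1) : 0 ≤ asymptoticLimit hT := by
  have hre := fun x => (Complex.continuous_re.tendsto _).comp (tendsto_inner_asymptoticLimit hT x)
  have him := fun x => (Complex.continuous_im.tendsto _).comp (tendsto_inner_asymptoticLimit hT x)
  refine nonneg_of_inner (fun x => (inner ℂ (asymptoticLimit hT x) x).re)
    (fun x => ?_) (fun x => ?_)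
  · refine ge_of_tendsto' (hre x) fun n => ?_
    rw [Function.comp_apply, Complex.ofReal_re]
    positivity
  · refine Complex.ext (by simp) ?_
    rw [Complex.ofReal_im]
    refine tendsto_nhds_unique (him x) ?_
    simp only [Function.comp_def, Complex.ofReal_im]
    exact tendsto_const_nhds

theorem asymptoticRoot_mul_self {T : H →L[ℂ] H} (hT : ‖T‖ ≤ 1) :
    asymptoticRoot hT * asymptoticRoot hT = asymptoticLimit hT :=
  CFC.sqrt_mul_sqrt_self _ (asymptoticLimit_nonneg hT)

theorem tendsto_norm_sq {T : H →L[ℂ] H} (hT : ‖T‖ ≤ 1) (x : H) :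
    Tendsto (fun n : ℕ => ‖(T ^ n) x‖ ^ 2) atTop (𝓝 (‖asymptoticRoot hT x‖ ^ 2)) := by
  have hsa : (asymptoticRoot hT)† = asymptoticRoot hT :=
    (CFC.sqrt_nonneg (asymptoticLimit hT)).isSelfAdjoint
  have h := inner_adjoint_mul_self (asymptoticRoot hT) x
  rw [hsa, asymptoticRoot_mul_self] at h
  have h2 := (Complex.continuous_re.tendsto _).comp (tendsto_inner_asymptoticLimit hT x)
  rw [h, Complex.ofReal_re] at h2
  exact h2.congr fun n => Complex.ofReal_re _

/-- The space `closure (Ran Q_T)`. -/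
abbrev AsymptoticSpace {T : H →L[ℂ] H} (hT : ‖T‖ ≤ 1) : Submodule ℂ H :=
  closedRange (asymptoticRoot hT)

/-- The operator `Q_T h ↦ Q_T (B h)` on `closure (Ran Q_T)`, for operators `B` that satisfy
`‖Q_T (B h)‖ ≤ ‖Q_T h‖`. -/
def asymptoticMap {T : H →L[ℂ] H} (hT : ‖T‖ ≤ 1) (B : H →L[ℂ] H) :
    AsymptoticSpace hT →L[ℂ] AsymptoticSpace hT :=
  pushforward (asymptoticRoot hT) B

theorem norm_asymptoticRoot_apply {T : H →L[ℂ] H} (hT : ‖T‖ ≤ 1) (x : H) :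
    ‖asymptoticRoot hT (T x)‖ = ‖asymptoticRoot hT x‖ := by
  have h1 := (tendsto_norm_sq hT x).comp (tendsto_add_atTop_nat 1)
  have h2 := tendsto_norm_sq hT (T x)
  have h3 := tendsto_nhds_unique h2 (h1.congr fun n => by
    simp only [Function.comp_apply, pow_succ, mul_apply_eq_comp])
  exact (sq_eq_sq₀ (norm_nonneg _) (norm_nonneg _)).1 h3

theorem asymptoticMap_apply {T : H →L[ℂ] H} (hT : ‖T‖ ≤ 1) {B : H →L[ℂ] H}
    (hB : ∀ x, ‖asymptoticRoot hT (B x)‖ ≤ ‖asymptoticRoot hT x‖) (x : H) :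
    asymptoticMap hT B (toClosedRange (asymptoticRoot hT) x) =
      toClosedRange (asymptoticRoot hT) (B x) :=
  pushforward_apply hB x

theorem asymptoticMap_isometry {T : H →L[ℂ] H} (hT : ‖T‖ ≤ 1) {B : H →L[ℂ] H}
    (hB : ∀ x, ‖asymptoticRoot hT (B x)‖ = ‖asymptoticRoot hT x‖) (y : AsymptoticSpace hT) :
    ‖asymptoticMap hT B y‖ = ‖y‖ := by
  refine (denseRange_toClosedRange (asymptoticRoot hT)).induction_on y
    (isClosed_eq (by fun_prop) (by fun_prop)) fun x => ?_
  rw [asymptoticMap_apply hT fun x => (hB x).le]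
  exact hB x

end Single

/-! ### Minimal unitary extensions of isometries -/

/-- A minimal unitary extension of the operator `V` on `E`: a unitary `U` on a space `𝒬` that
contains `E` (through the isometric embedding `emb`), with `U|_E = V`, such that `𝒬` is the closed
span of the subspaces `(U*)ⁿ E`, `n ≥ 0`. -/
structure MinimalUnitaryExtension {E : Type*} [NormedAddCommGroup E] [InnerProductSpace ℂ E]
    (V : E →L[ℂ] E) (𝒬 : Type*) [NormedAddCommGroup 𝒬] [InnerProductSpace ℂ 𝒬]
    [CompleteSpace 𝒬] where
  /-- the inclusion of `E` -/
  emb : E →ₗᵢ[ℂ] 𝒬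
  /-- the unitary extension -/
  U : 𝒬 →L[ℂ] 𝒬
  unitary : U ∈ unitary (𝒬 →L[ℂ] 𝒬)
  extends_op : ∀ x, U (emb x) = emb (V x)
  minimal :
    (Submodule.span ℂ {y : 𝒬 | ∃ (n : ℕ) (x : E), ((U†) ^ n) (emb x) = y}).topologicalClosure = ⊤

section Unitary

variable {K : Type*} [NormedAddCommGroup K] [InnerProductSpace ℂ K] [CompleteSpace K]

theorem adjoint_mul_self_of_isometry {A : K →L[ℂ] K} (h : ∀ x, ‖A x‖ = ‖x‖) : A† * A = 1 :=
  (ContinuousLinearMap.norm_map_iff_adjoint_comp_self A).1 h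

theorem mem_unitary_of_isometry {A B : K →L[ℂ] K} (h : ∀ x, ‖A x‖ = ‖x‖) (hB : A * B = 1) :
    A ∈ unitary (K →L[ℂ] K) := by
  have h1 : star A * A = 1 := adjoint_mul_self_of_isometry h
  refine Unitary.mem_iff.2 ⟨h1, ?_⟩
  have h2 : star A = B := by
    rw [← mul_one (star A), ← hB, ← mul_assoc, h1, one_mul]
  rw [h2, hB]

theorem minimal_of_inner_eq_zero {E : Type*} {U : K →L[ℂ] K} {f : E → K}
    (h : ∀ y, (∀ n x, inner ℂ (f x) ((U ^ n) y) = 0) → y = 0) :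
    (Submodule.span ℂ {y : K | ∃ (n : ℕ) (x : E), ((U†) ^ n) (f x) = y}).topologicalClosure
      = ⊤ := by
  rw [Submodule.topologicalClosure_eq_top_iff, Submodule.eq_bot_iff]
  refine fun y hy => h y fun n x => ?_
  have h2 := (Submodule.mem_orthogonal _ _).1 hy _ (Submodule.subset_span ⟨n, x, rfl⟩)
  have h3 : (U†) ^ n = (U ^ n)† := (star_pow _ n).symm
  rwa [h3, ContinuousLinearMap.adjoint_inner_left] at h2

end Unitary

section Existence

variable {E : Type*} [NormedAddCommGroup E] [InnerProductSpace ℂ E] [CompleteSpace E]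

/-- The operator `(e, (aₙ)) ↦ (V e + a₀, (aₙ₊₁))` on `E ⊕ ℓ²(ker V*)`. -/
def extensionOp (V : E →L[ℂ] E) :
    WithLp 2 (E × Hardy (V†).ker) →L[ℂ] WithLp 2 (E × Hardy (V†).ker) :=
  ((WithLp.prodContinuousLinearEquiv 2 ℂ E (Hardy (V†).ker)).symm : _ →L[ℂ] _) ∘L
    ContinuousLinearMap.prod
      (V ∘L WithLp.fstL 2 ℂ E (Hardy (V†).ker) +
        ((V†).ker.subtypeL ∘L lp.evalCLM ℂ (fun _ : ℕ => (V†).ker) 2 0) ∘L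
          WithLp.sndL 2 ℂ E (Hardy (V†).ker))
      (Hardy.backShift ∘L WithLp.sndL 2 ℂ E (Hardy (V†).ker))

theorem extensionOp_fst (V : E →L[ℂ] E) (y : WithLp 2 (E × Hardy (V†).ker)) :
    (extensionOp V y).fst = V y.fst + (y.snd 0 : (V†).ker) := rfl

theorem extensionOp_snd (V : E →L[ℂ] E) (y : WithLp 2 (E × Hardy (V†).ker)) :
    (extensionOp V y).snd = Hardy.backShift y.snd := rfl

theorem extensionOp_isometry (V : E →L[ℂ] E) (hV : ∀ x, ‖V x‖ = ‖x‖)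
    (y : WithLp 2 (E × Hardy (V†).ker)) : ‖extensionOp V y‖ = ‖y‖ := by
  refine (sq_eq_sq₀ (norm_nonneg _) (norm_nonneg _)).1 ?_
  have h0 : inner ℂ (V y.fst) ((y.snd 0 : (V†).ker) : E) = 0 := by
    rw [← ContinuousLinearMap.adjoint_inner_right]
    have : (V†) ((y.snd 0 : (V†).ker) : E) = 0 := (y.snd 0).2
    rw [this, inner_zero_right]
  rw [WithLp.prod_norm_sq_eq_of_L2, WithLp.prod_norm_sq_eq_of_L2, extensionOp_fst, extensionOp_snd,
    Hardy.norm_sq, Hardy.norm_sq y.snd, (Hardy.summable_sq y.snd).tsum_eq_zero_add, sq ‖_ + _‖,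
    norm_add_sq_eq_norm_sq_add_norm_sq_of_inner_eq_zero _ _ h0, hV]
  simp only [Hardy.backShift_apply, Submodule.coe_norm]
  ring

theorem extensionOp_surjective (V : E →L[ℂ] E) (hV : ∀ x, ‖V x‖ = ‖x‖) :
    Function.Surjective (extensionOp V) := by
  intro y
  have hVV : ∀ x, (V†) (V x) = x := fun x =>
    congrArg (fun A : E →L[ℂ] E => A x) (adjoint_mul_self_of_isometry hV)
  have hk : y.fst - V ((V†) y.fst) ∈ (V†).ker := by
    rw [LinearMap.mem_ker]
    simp [hVV]
  refine ⟨WithLp.toLp 2 ((V†) y.fst,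
    Hardy.shift y.snd + lp.single 2 0 (⟨y.fst - V ((V†) y.fst), hk⟩ : (V†).ker)), ?_⟩
  refine WithLp.ofLp_injective 2 (Prod.ext ?_ ?_)
  · refine (extensionOp_fst V _).trans ?_
    simp
  · refine (extensionOp_snd V _).trans ?_
    ext n
    simp

/-- The inclusion of `E` into `E ⊕ ℓ²(ker V*)`. -/
def extensionEmb (V : E →L[ℂ] E) : E →ₗᵢ[ℂ] WithLp 2 (E × Hardy (V†).ker) where
  toFun := fun x => WithLp.toLp 2 (x, 0)
  map_add' := fun x y => WithLp.ofLp_injective 2 (Prod.ext rfl (add_zero _).symm)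
  map_smul' := fun c x => WithLp.ofLp_injective 2 (Prod.ext rfl (smul_zero _).symm)
  norm_map' := fun x => by simp

theorem extensionOp_minimal (V : E →L[ℂ] E) (y : WithLp 2 (E × Hardy (V†).ker))
    (hy : ∀ n x, inner ℂ (extensionEmb V x) ((extensionOp V ^ n) y) = 0) : y = 0 := by
  have h1 : ∀ n, ((extensionOp V ^ n) y).fst = 0 := fun n => by
    refine ext_inner_left ℂ fun x => ?_
    have h2 := hy n x
    rw [WithLp.prod_inner_apply] at h2
    change inner ℂ x _ + inner ℂ 0 _ = 0 at h2
    rw [inner_zero_left, add_zero] at h2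
    rw [inner_zero_right]
    exact h2
  have h4 : ∀ n k, ((extensionOp V ^ n) y).snd k = y.snd (k + n) := fun n => by
    induction n with
    | zero => intro k; rfl
    | succ n ih =>
      intro k
      rw [pow_succ', mul_apply_eq_comp, extensionOp_snd, Hardy.backShift_apply, ih]
      rw [show k + 1 + n = k + (n + 1) by omega]
  have h5 : ∀ n, y.snd n = 0 := fun n => by
    have h6 := h1 (n + 1)
    rw [pow_succ', mul_apply_eq_comp, extensionOp_fst, h1, map_zero, zero_add, h4,
      zero_add] at h6
    exact Subtype.ext h6
  refine WithLp.ofLp_injective 2 (Prod.ext (h1 0) ?_)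
  ext n
  exact congrArg Subtype.val (h5 n)

theorem extensionOp_unitary (V : E →L[ℂ] E) (hV : ∀ x, ‖V x‖ = ‖x‖) :
    extensionOp V ∈ unitary (WithLp 2 (E × Hardy (V†).ker) →L[ℂ] _) := by
  have h1 := adjoint_mul_self_of_isometry (extensionOp_isometry V hV)
  refine mem_unitary_of_isometry (B := (extensionOp V)†) (extensionOp_isometry V hV) ?_
  ext1 y
  obtain ⟨x, rfl⟩ := extensionOp_surjective V hV y
  exact congrArg (fun A => extensionOp V (A x)) h1

/-- Every isometry has a minimal unitary extension. -/
def MinimalUnitaryExtension.ofIsometry (V : E →L[ℂ] E) (hV : ∀ x, ‖V x‖ = ‖x‖) :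
    MinimalUnitaryExtension V (WithLp 2 (E × Hardy (V†).ker)) where
  emb := extensionEmb V
  U := extensionOp V
  unitary := extensionOp_unitary V hV
  extends_op := fun _ => WithLp.ofLp_injective 2
    (Prod.ext (add_zero _) (map_zero Hardy.backShift))
  minimal := minimal_of_inner_eq_zero (extensionOp_minimal V)

end Existence

/-! ### Lifting operators to a minimal unitary extension -/

namespace MinimalUnitaryExtension

variable {E : Type*} [NormedAddCommGroup E] [InnerProductSpace ℂ E]
  {V : E →L[ℂ] E} {𝒬 : Type*} [NormedAddCommGroup 𝒬] [InnerProductSpace ℂ 𝒬]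
  [CompleteSpace 𝒬] (M : MinimalUnitaryExtension V 𝒬)

theorem U_adjoint_mul : M.U† * M.U = 1 := (Unitary.mem_iff.1 M.unitary).1

theorem U_mul_adjoint : M.U * M.U† = 1 := (Unitary.mem_iff.1 M.unitary).2

theorem norm_U (y : 𝒬) : ‖M.U y‖ = ‖y‖ :=
  (ContinuousLinearMap.norm_map_iff_adjoint_comp_self M.U).2 M.U_adjoint_mul y

/-- The map `(xₙ) ↦ ∑ₙ cⁿ (U*)ⁿ (X xₙ)` on finitely supported sequences. -/
def sumMap (c : ℂ) (X : E →ₗ[ℂ] E) : (ℕ →₀ E) →ₗ[ℂ] 𝒬 :=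
  Finsupp.lsum ℂ fun n : ℕ =>
    c ^ n • (((M.U†) ^ n : 𝒬 →L[ℂ] 𝒬) : 𝒬 →ₗ[ℂ] 𝒬) ∘ₗ M.emb.toLinearMap ∘ₗ X

theorem sumMap_single (c : ℂ) (X : E →ₗ[ℂ] E) (n : ℕ) (x : E) :
    M.sumMap c X (Finsupp.single n x) = c ^ n • ((M.U†) ^ n) (M.emb (X x)) := by
  rw [sumMap, Finsupp.lsum_single]
  rfl

theorem denseRange_sumMap : DenseRange (M.sumMap 1 LinearMap.id) := by
  have h : (Submodule.span ℂ {y : 𝒬 | ∃ (n : ℕ) (x : E), ((M.U†) ^ n) (M.emb x) = y}) ≤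
      LinearMap.range (M.sumMap 1 LinearMap.id) := by
    refine Submodule.span_le.2 ?_
    rintro _ ⟨n, x, rfl⟩
    exact ⟨Finsupp.single n x, by simp [sumMap_single]⟩
  have h2 := Submodule.topologicalClosure_mono h
  rw [M.minimal, top_le_iff] at h2
  intro y
  have h3 : y ∈ (LinearMap.range (M.sumMap 1 LinearMap.id)).topologicalClosure := h2 ▸ trivial
  exact h3

theorem pow_U_sumMap (c : ℂ) (hc : ‖c‖ = 1) (X : E →L[ℂ] E)
    (hX : X ∘L V = c • V ∘L X) (s : ℕ →₀ E) (N : ℕ) (hN : ∀ n ∈ s.support, n ≤ N) :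
    (M.U ^ N) (M.sumMap c⁻¹ X s) =
      (c⁻¹) ^ N • M.emb (X (s.sum fun n x => (V ^ (N - n)) x)) := by
  have hc0 : c ≠ 0 := by rintro rfl; simp at hc
  have hXV : ∀ (k : ℕ) (x : E), X ((V ^ k) x) = c ^ k • (V ^ k) (X x) := fun k => by
    induction k with
    | zero => simp
    | succ k ih =>
      intro x
      have h := congrArg (fun A : E →L[ℂ] E => A ((V ^ k) x)) hX
      simp only [ContinuousLinearMap.comp_apply, smul_apply] at h
      rw [pow_succ' V, mul_apply_eq_comp, h, ih, mul_apply_eq_comp, map_smul, smul_smul, pow_succ']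
  have hU : ∀ (k : ℕ) (x : E), (M.U ^ k) (M.emb x) = M.emb ((V ^ k) x) := fun k => by
    induction k with
    | zero => simp
    | succ k ih =>
      intro x
      rw [pow_succ' M.U, mul_apply_eq_comp, ih, M.extends_op, pow_succ' V, mul_apply_eq_comp]
  have hUU : ∀ n : ℕ, M.U ^ n * (M.U†) ^ n = 1 := fun n => by
    rw [← (show Commute M.U (M.U†) from M.U_mul_adjoint.trans M.U_adjoint_mul.symm).mul_pow,
      M.U_mul_adjoint, one_pow]
  rw [sumMap, Finsupp.lsum_apply, Finsupp.sum, Finsupp.sum, map_sum, map_sum, map_sum,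
    Finset.smul_sum]
  refine Finset.sum_congr rfl fun n hn => ?_
  have hle := hN n hn
  have h1 : (M.U ^ N) (((M.U†) ^ n) (M.emb (X (s n)))) = M.emb ((V ^ (N - n)) (X (s n))) := by
    rw [← hU, ← mul_apply_eq_comp, ← Nat.sub_add_cancel hle, pow_add, mul_assoc, hUU, mul_one,
      Nat.add_sub_cancel]
  have h2 : (c⁻¹) ^ n = (c⁻¹) ^ N * c ^ (N - n) := by
    have : (c⁻¹) ^ N = (c⁻¹) ^ n * (c⁻¹) ^ (N - n) := by rw [← pow_add, Nat.add_sub_cancel' hle]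
    rw [this, mul_assoc, ← mul_pow, inv_mul_cancel₀ hc0, one_pow, mul_one]
  rw [hXV, map_smul, smul_smul, ← h2, ← h1, ← map_smul]
  rfl

theorem norm_sumMap (c : ℂ) (hc : ‖c‖ = 1) (X : E →L[ℂ] E) (hX : X ∘L V = c • V ∘L X)
    (hi : ∀ x, ‖X x‖ = ‖x‖) (s : ℕ →₀ E) :
    ‖M.sumMap c⁻¹ X s‖ = ‖M.sumMap 1 LinearMap.id s‖ := by
  have hn : ∀ (N : ℕ) (y : 𝒬), ‖(M.U ^ N) y‖ = ‖y‖ := fun N => by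
    induction N with
    | zero => simp
    | succ N ih => intro y; rw [pow_succ', mul_apply_eq_comp, M.norm_U, ih]
  set N := s.support.sup id with hN
  have hle : ∀ n ∈ s.support, n ≤ N := fun n hn => Finset.le_sup (f := id) hn
  have h1 := M.pow_U_sumMap c hc X hX s N hle
  have h2 := M.pow_U_sumMap 1 (by simp) (ContinuousLinearMap.id ℂ E) (by simp) s N hle
  have h3 : M.sumMap 1⁻¹ (ContinuousLinearMap.id ℂ E : E →ₗ[ℂ] E) s =
      M.sumMap 1 LinearMap.id s := by rw [inv_one]; rfl
  rw [h3] at h2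
  rw [← hn N, h1, ← hn N (M.sumMap 1 LinearMap.id s), h2]
  simp [norm_smul, hc, hi]

/-- An isometry that commutes with `V` up to a unimodular constant extends to `𝒬`. -/
theorem exists_lift (c : ℂ) (hc : ‖c‖ = 1) (X : E →L[ℂ] E) (hX : X ∘L V = c • V ∘L X)
    (hi : ∀ x, ‖X x‖ = ‖x‖) :
    ∃ Y : 𝒬 →L[ℂ] 𝒬, (∀ x, Y (M.emb x) = M.emb (X x)) ∧ Y * M.U = c • (M.U * Y) ∧
      ∀ y, ‖Y y‖ = ‖y‖ := by
  have hc0 : c ≠ 0 := by rintro rfl; simp at hc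
  set Y : 𝒬 →L[ℂ] 𝒬 := (M.sumMap c⁻¹ X).extendOfNorm (M.sumMap 1 LinearMap.id) with hYdef
  have hY : ∀ s, Y (M.sumMap 1 LinearMap.id s) = M.sumMap c⁻¹ X s := fun s =>
    LinearMap.extendOfNorm_eq M.denseRange_sumMap
      ⟨1, fun s => by rw [one_mul, M.norm_sumMap c hc X hX hi]⟩ s
  have hYn : ∀ n x, Y (((M.U†) ^ n) (M.emb x)) = (c⁻¹) ^ n • ((M.U†) ^ n) (M.emb (X x)) :=
    fun n x => by
      have := hY (Finsupp.single n x)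
      simpa [sumMap_single] using this
  have hYU : Y * M.U† = c⁻¹ • (M.U† * Y) := by
    ext1 y
    refine M.denseRange_sumMap.induction_on y (isClosed_eq (by fun_prop) (by fun_prop)) fun s => ?_
    induction s using Finsupp.induction_linear with
    | zero => simp
    | add s t hs ht => rw [map_add, map_add, map_add, hs, ht]
    | single n x =>
      rw [sumMap_single]
      simp only [one_pow, one_smul, LinearMap.id_apply, mul_apply_eq_comp, smul_apply]
      rw [hYn, ← mul_apply_eq_comp (M.U†), ← pow_succ', hYn, map_smul, smul_smul, pow_succ',
        pow_succ' (M.U†), mul_apply_eq_comp]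
  refine ⟨Y, fun x => by simpa using hYn 0 x, ?_, fun y => ?_⟩
  · have h1 : M.U * (Y * M.U†) * M.U = c⁻¹ • (M.U * (M.U† * Y) * M.U) := by
      rw [hYU, mul_smul_comm, smul_mul_assoc]
    rw [mul_assoc, mul_assoc, M.U_adjoint_mul, mul_one, ← mul_assoc M.U, M.U_mul_adjoint,
      one_mul] at h1
    rw [h1, smul_smul, mul_inv_cancel₀ hc0, one_smul]
  · refine M.denseRange_sumMap.induction_on y (isClosed_eq (by fun_prop) (by fun_prop)) fun s => ?_
    rw [hY, M.norm_sumMap c hc X hX hi]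

/-- Operators that commute with `U` up to the same constant and agree on `E` are equal. -/
theorem lift_unique (c : ℂ) (hc : c ≠ 0) {Y Z : 𝒬 →L[ℂ] 𝒬} (hY : Y * M.U = c • (M.U * Y))
    (hZ : Z * M.U = c • (M.U * Z)) (h : ∀ x, Y (M.emb x) = Z (M.emb x)) : Y = Z := by
  have key : ∀ A : 𝒬 →L[ℂ] 𝒬, A * M.U = c • (M.U * A) →
      A * M.U† = c⁻¹ • (M.U† * A) := fun A hA => by
    have h1 : M.U† * (A * M.U) * M.U† = c • (M.U† * (M.U * A) * M.U†) := by
      rw [hA, mul_smul_comm, smul_mul_assoc]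
    rw [mul_assoc, mul_assoc, M.U_mul_adjoint, mul_one, ← mul_assoc (M.U†) M.U, M.U_adjoint_mul,
      one_mul] at h1
    rw [h1, smul_smul, inv_mul_cancel₀ hc, one_smul]
  have hn : ∀ (n : ℕ) x, Y (((M.U†) ^ n) (M.emb x)) = Z (((M.U†) ^ n) (M.emb x)) := fun n => by
    induction n with
    | zero => simpa using h
    | succ n ih =>
      intro x
      have h1 := congrArg (fun A : 𝒬 →L[ℂ] 𝒬 => A (((M.U†) ^ n) (M.emb x))) (key Y hY)
      have h2 := congrArg (fun A : 𝒬 →L[ℂ] 𝒬 => A (((M.U†) ^ n) (M.emb x))) (key Z hZ)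
      simp only [mul_apply_eq_comp, smul_apply] at h1 h2
      rw [pow_succ', mul_apply_eq_comp, h1, h2, ih]
  ext1 y
  refine M.denseRange_sumMap.induction_on y (isClosed_eq (by fun_prop) (by fun_prop)) fun s => ?_
  induction s using Finsupp.induction_linear with
  | zero => simp
  | add s t hs ht => rw [map_add, map_add, map_add, hs, ht]
  | single n x => simpa [sumMap_single] using hn n x

end MinimalUnitaryExtension

/-! ### Pairs of `q`-commuting contractions -/

section Pair

variable {H : Type*} [NormedAddCommGroup H] [InnerProductSpace ℂ H] [CompleteSpace H]

/-- `(T₁, T₂)` is a pair of `q`-commuting contractions: `T₁ T₂ = q T₂ T₁`. -/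
structure IsQCommutingContractivePair (q : Circle) (T₁ T₂ : H →L[ℂ] H) : Prop where
  norm_left : ‖T₁‖ ≤ 1
  norm_right : ‖T₂‖ ≤ 1
  comm : T₁ * T₂ = (q : ℂ) • (T₂ * T₁)

namespace IsQCommutingContractivePair

variable {q : Circle} {T₁ T₂ : H →L[ℂ] H}

theorem norm_prod (h : IsQCommutingContractivePair q T₁ T₂) : ‖T₁ * T₂‖ ≤ 1 :=
  (norm_mul_le _ _).trans (mul_le_one₀ h.norm_left (norm_nonneg _) h.norm_right)

/-- The adjoint of `T = T₁ T₂` is a contraction. -/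
theorem norm_adj (h : IsQCommutingContractivePair q T₁ T₂) :
    ‖(T₁ * T₂)†‖ ≤ 1 := norm_adjoint_le_one h.norm_prod

theorem adj_eq (_ : IsQCommutingContractivePair q T₁ T₂) :
    (T₁ * T₂)† = T₂† * T₁† := star_mul T₁ T₂

theorem adj_comm (h : IsQCommutingContractivePair q T₁ T₂) :
    T₁† * T₂† = (q : ℂ) • (T₁ * T₂)† := by
  have h1 : (T₂ * T₁)† = T₁† * T₂† := star_mul T₂ T₁
  rw [h.comm, LinearIsometryEquiv.map_smulₛₗ, h1, smul_smul, Complex.mul_conj]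
  simp

theorem adj_comm_left (h : IsQCommutingContractivePair q T₁ T₂) :
    T₁† * (T₁ * T₂)† = (q : ℂ) • ((T₁ * T₂)† * T₁†) := by
  rw [← smul_mul_assoc, ← h.adj_comm, h.adj_eq, mul_assoc]

theorem adj_comm_right (h : IsQCommutingContractivePair q T₁ T₂) :
    T₂† * (T₁ * T₂)† = (q : ℂ)⁻¹ • ((T₁ * T₂)† * T₂†) := by
  have h1 : (T₁ * T₂)† * T₂† = (q : ℂ) • (T₂† * (T₁ * T₂)†) := by
    rw [← mul_smul_comm, ← h.adj_comm, h.adj_eq, mul_assoc]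
  rw [h1, smul_smul, inv_mul_cancel₀ (Circle.coe_ne_zero q), one_smul]

end IsQCommutingContractivePair

/-! ### Fundamental operators -/

/-- `(G₁, G₂)`, acting on `𝒟_{T*}` for `T = T₁ T₂`, is a solution of the fundamental equations
`D_{T*} G₁ D_{T*} = T₁* - T₂ T*` and `D_{T*} G₂ D_{T*} = T₂* - q T₁ T*`. -/
structure IsFundamentalPair (q : Circle) (T₁ T₂ : H →L[ℂ] H)
    (G : (DefectSpace ((T₁ * T₂)†) →L[ℂ] DefectSpace ((T₁ * T₂)†)) ×
      (DefectSpace ((T₁ * T₂)†) →L[ℂ] DefectSpace ((T₁ * T₂)†))) : Prop where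
  left : ∀ x, defectOp ((T₁ * T₂)†) (G.1 (toClosedRange (defectOp ((T₁ * T₂)†)) x)) =
    (T₁†) x - T₂ (((T₁ * T₂)†) x)
  right : ∀ x, defectOp ((T₁ * T₂)†) (G.2 (toClosedRange (defectOp ((T₁ * T₂)†)) x)) =
    (T₂†) x - (q : ℂ) • T₁ (((T₁ * T₂)†) x)

theorem exists_factor {A B : H →L[ℂ] H} (hAB : ∀ x, ‖B x‖ ≤ ‖A x‖) :
    ∃ C : closedRange A →L[ℂ] H, ∀ x, C (toClosedRange A x) = B x :=
  ⟨(B : H →ₗ[ℂ] H).extendOfNorm (toClosedRange A : H →ₗ[ℂ] closedRange A), fun x =>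
    LinearMap.extendOfNorm_eq (f := (B : H →ₗ[ℂ] H))
      (e := (toClosedRange A : H →ₗ[ℂ] closedRange A))
      (denseRange_toClosedRange A) ⟨1, fun x => by simpa using hAB x⟩ x⟩

theorem inner_toClosedRange {A : H →L[ℂ] H} (hA : A† = A) (y : closedRange A) (x : H) :
    inner ℂ (A y) x = inner ℂ y (toClosedRange A x) := by
  nth_rw 1 [← hA]
  rw [ContinuousLinearMap.adjoint_inner_left, Submodule.coe_inner, coe_toClosedRange]

/-- If `S, R` are contractions with `‖S* R* x‖ ≥ ‖T* x‖` and `‖S* x‖ ≥ ‖T* x‖` then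
`D_{T*} G D_{T*} = (I - S S*) R*` has a solution `G`. -/
theorem exists_fundamental {T S R : H →L[ℂ] H} (hT : ‖T†‖ ≤ 1) (hS : ‖S†‖ ≤ 1) (hR : ‖R†‖ ≤ 1)
    (h1 : ∀ x, ‖(T†) x‖ ≤ ‖(S†) ((R†) x)‖) (h2 : ∀ x, ‖(T†) x‖ ≤ ‖(S†) x‖) :
    ∃ G : DefectSpace (T†) →L[ℂ] DefectSpace (T†),
      ∀ x, defectOp (T†) (G (toClosedRange (defectOp (T†)) x)) = (R†) x - S ((S†) ((R†) x)) := by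
  obtain ⟨C, hC⟩ := exists_factor (A := defectOp (T†)) (B := defectOp (S†) * R†) (fun x => by
    refine le_of_sq_le_sq ?_ (norm_nonneg _)
    rw [mul_apply_eq_comp, norm_defectOp_sq hT, norm_defectOp_sq hS]
    have := pow_le_pow_left₀ (norm_nonneg _) (h1 x) 2
    have := pow_le_pow_left₀ (norm_nonneg _) (norm_apply_le_of_contraction hR x) 2
    linarith)
  obtain ⟨C', hC'⟩ := exists_factor (A := defectOp (T†)) (B := defectOp (S†)) (fun x => by
    refine le_of_sq_le_sq ?_ (norm_nonneg _)
    rw [norm_defectOp_sq hT, norm_defectOp_sq hS]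
    have := pow_le_pow_left₀ (norm_nonneg _) (h2 x) 2
    linarith)
  refine ⟨C'† ∘L C, fun x => ext_inner_right ℂ fun y => ?_⟩
  rw [inner_toClosedRange (isSelfAdjoint_defectOp _), ContinuousLinearMap.comp_apply,
    ContinuousLinearMap.adjoint_inner_left, hC, hC', mul_apply_eq_comp]
  nth_rw 2 [← isSelfAdjoint_defectOp]
  rw [ContinuousLinearMap.adjoint_inner_right, ← mul_apply_eq_comp, defectOp_mul_self hS]
  simp

theorem fundamental_unique {A : H →L[ℂ] H} (hA : A† = A)
    {G G' : closedRange A →L[ℂ] closedRange A}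
    (h : ∀ x, A (G (toClosedRange A x)) = A (G' (toClosedRange A x))) : G = G' := by
  ext1 y
  refine (denseRange_toClosedRange A).induction_on y
    (isClosed_eq (by fun_prop) (by fun_prop)) fun x => ?_
  refine ext_inner_right ℂ fun z => ?_
  refine (denseRange_toClosedRange A).induction_on z
    (isClosed_eq (by fun_prop) (by fun_prop)) fun w => ?_
  rw [← inner_toClosedRange hA, ← inner_toClosedRange hA, h]

theorem existsUnique_fundamentalPair {q : Circle} {T₁ T₂ : H →L[ℂ] H}
    (h : IsQCommutingContractivePair q T₁ T₂) : ∃! G, IsFundamentalPair q T₁ T₂ G := by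
  have e1 : ∀ x, ((T₁ * T₂)†) x = (T₂†) ((T₁†) x) := fun x => by
    rw [h.adj_eq, mul_apply_eq_comp]
  have e2 : ∀ x, (T₁†) ((T₂†) x) = (q : ℂ) • ((T₁ * T₂)†) x := fun x => by
    rw [← mul_apply_eq_comp, h.adj_comm, smul_apply]
  have n2 : ∀ x, ‖(T₁†) ((T₂†) x)‖ = ‖((T₁ * T₂)†) x‖ := fun x => by
    rw [e2, norm_smul, Circle.norm_coe, one_mul]
  have hl := norm_adjoint_le_one h.norm_left
  have hr := norm_adjoint_le_one h.norm_right
  obtain ⟨G₁, hG₁⟩ := exists_fundamental (T := T₁ * T₂) (S := T₂) (R := T₁) h.norm_adj hr hl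
    (fun x => by rw [e1]) (fun x => by
      rw [← n2]; exact norm_apply_le_of_contraction hl _)
  obtain ⟨G₂, hG₂⟩ := exists_fundamental (T := T₁ * T₂) (S := T₁) (R := T₂) h.norm_adj hl hr
    (fun x => by rw [n2]) (fun x => by
      rw [e1]; exact norm_apply_le_of_contraction hr _)
  refine ⟨(G₁, G₂), ⟨fun x => by rw [hG₁, e1], fun x => by rw [hG₂, e2, map_smul]⟩, ?_⟩
  rintro ⟨G, G'⟩ ⟨h1, h2⟩
  refine Prod.ext (fundamental_unique (isSelfAdjoint_defectOp _) fun x => ?_)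
    (fundamental_unique (isSelfAdjoint_defectOp _) fun x => ?_)
  · exact (h1 x).trans (by rw [hG₁, e1])
  · exact (h2 x).trans (by rw [hG₂, e2, map_smul])

/-- The fundamental operators `(G₁, G₂)` of `(T₁*, T₂*)`: the unique solution of the fundamental
equations. -/
def fundamentalOps {q : Circle} {T₁ T₂ : H →L[ℂ] H} (h : IsQCommutingContractivePair q T₁ T₂) :
    (DefectSpace ((T₁ * T₂)†) →L[ℂ] DefectSpace ((T₁ * T₂)†)) ×
      (DefectSpace ((T₁ * T₂)†) →L[ℂ] DefectSpace ((T₁ * T₂)†)) :=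
  (existsUnique_fundamentalPair h).choose

/-! ### The canonical unitary pair -/

theorem norm_asymptoticRoot_le {T B : H →L[ℂ] H} (hT : ‖T‖ ≤ 1) (hB : ‖B‖ ≤ 1) {c : ℂ}
    (hc : ‖c‖ = 1) (h : B * T = c • (T * B)) (x : H) :
    ‖asymptoticRoot hT (B x)‖ ≤ ‖asymptoticRoot hT x‖ := by
  have h1 : ∀ (n : ℕ), B * T ^ n = c ^ n • (T ^ n * B) := fun n => by
    induction n with
    | zero => simp
    | succ n ih =>
      rw [pow_succ, ← mul_assoc, ih, smul_mul_assoc, mul_assoc, h, mul_smul_comm, smul_smul,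
        ← mul_assoc, pow_succ]
  refine le_of_sq_le_sq ?_ (norm_nonneg _)
  refine le_of_tendsto_of_tendsto' (tendsto_norm_sq hT (B x)) (tendsto_norm_sq hT x) fun n => ?_
  have h2 : ‖(T ^ n) (B x)‖ = ‖B ((T ^ n) x)‖ := by
    rw [← mul_apply_eq_comp B, h1, smul_apply, norm_smul, norm_pow, hc, one_pow, one_mul,
      mul_apply_eq_comp]
  rw [h2]
  exact pow_le_pow_left₀ (norm_nonneg _) (norm_apply_le_of_contraction hB _) 2

variable {q : Circle} {T₁ T₂ : H →L[ℂ] H} (h : IsQCommutingContractivePair q T₁ T₂)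

/-- The isometry `X*` on `closure (Ran Q_{T*})`, `X* Q_{T*} x = Q_{T*} T* x`, for `T = T₁ T₂`. -/
def adjX : AsymptoticSpace h.norm_adj →L[ℂ] AsymptoticSpace h.norm_adj :=
  asymptoticMap h.norm_adj ((T₁ * T₂)†)

/-- The operator `X₁*` on `closure (Ran Q_{T*})`, `X₁* Q_{T*} x = Q_{T*} T₁* x`. -/
def adjX₁ : AsymptoticSpace h.norm_adj →L[ℂ] AsymptoticSpace h.norm_adj :=
  asymptoticMap h.norm_adj (T₁†)

/-- The operator `X₂*` on `closure (Ran Q_{T*})`, `X₂* Q_{T*} x = Q_{T*} T₂* x`. -/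
def adjX₂ : AsymptoticSpace h.norm_adj →L[ℂ] AsymptoticSpace h.norm_adj :=
  asymptoticMap h.norm_adj (T₂†)

theorem adjX_apply (x : H) : adjX h (toClosedRange (asymptoticRoot h.norm_adj) x) =
    toClosedRange (asymptoticRoot h.norm_adj) (((T₁ * T₂)†) x) :=
  asymptoticMap_apply _ (fun x => (norm_asymptoticRoot_apply h.norm_adj x).le) x

theorem norm_inv_q (q : Circle) : ‖(q : ℂ)⁻¹‖ = 1 := by
  rw [norm_inv, Circle.norm_coe, inv_one]

theorem norm_le₁ (x : H) :
    ‖asymptoticRoot h.norm_adj ((T₁†) x)‖ ≤ ‖asymptoticRoot h.norm_adj x‖ :=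
  norm_asymptoticRoot_le h.norm_adj (norm_adjoint_le_one h.norm_left) (Circle.norm_coe q)
    h.adj_comm_left x

theorem norm_le₂ (x : H) :
    ‖asymptoticRoot h.norm_adj ((T₂†) x)‖ ≤ ‖asymptoticRoot h.norm_adj x‖ :=
  norm_asymptoticRoot_le h.norm_adj (norm_adjoint_le_one h.norm_right) (norm_inv_q q)
    h.adj_comm_right x

theorem adjX₁_apply (x : H) : adjX₁ h (toClosedRange (asymptoticRoot h.norm_adj) x) =
    toClosedRange (asymptoticRoot h.norm_adj) ((T₁†) x) :=
  asymptoticMap_apply _ (norm_le₁ h) x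

theorem adjX₂_apply (x : H) : adjX₂ h (toClosedRange (asymptoticRoot h.norm_adj) x) =
    toClosedRange (asymptoticRoot h.norm_adj) ((T₂†) x) :=
  asymptoticMap_apply _ (norm_le₂ h) x

theorem adjX_isometry (y : AsymptoticSpace h.norm_adj) : ‖adjX h y‖ = ‖y‖ :=
  asymptoticMap_isometry _ (norm_asymptoticRoot_apply h.norm_adj) y

theorem adjX₁_isometry (y : AsymptoticSpace h.norm_adj) : ‖adjX₁ h y‖ = ‖y‖ := by
  refine asymptoticMap_isometry _ (fun x => le_antisymm (norm_le₁ h x) ?_) y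
  refine le_of_eq_of_le ?_ (norm_le₂ h _)
  rw [← mul_apply_eq_comp (T₂†), ← h.adj_eq, norm_asymptoticRoot_apply]

theorem adjX₂_isometry (y : AsymptoticSpace h.norm_adj) : ‖adjX₂ h y‖ = ‖y‖ := by
  refine asymptoticMap_isometry _ (fun x => le_antisymm (norm_le₂ h x) ?_) y
  refine le_of_eq_of_le ?_ (norm_le₁ h _)
  rw [← mul_apply_eq_comp (T₁†), h.adj_comm, smul_apply, map_smul, norm_smul, Circle.norm_coe,
    one_mul, norm_asymptoticRoot_apply]

theorem asymptotic_ext {A B : AsymptoticSpace h.norm_adj →L[ℂ] AsymptoticSpace h.norm_adj}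
    (hAB : ∀ x, A (toClosedRange (asymptoticRoot h.norm_adj) x) =
      B (toClosedRange (asymptoticRoot h.norm_adj) x)) : A = B := by
  ext1 y
  exact (denseRange_toClosedRange (asymptoticRoot h.norm_adj)).induction_on y
    (isClosed_eq (by fun_prop) (by fun_prop)) hAB

variable {𝒬 : Type*} [NormedAddCommGroup 𝒬] [InnerProductSpace ℂ 𝒬] [CompleteSpace 𝒬]

/-- The unitary `W_D` on `𝒬`: the adjoint `W_D*` is the minimal unitary extension of `X*`. -/
def unitaryD {h : IsQCommutingContractivePair q T₁ T₂} (M : MinimalUnitaryExtension (adjX h) 𝒬) :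
    𝒬 →L[ℂ] 𝒬 := M.U†

/-- `(W₁, W₂)` is a `q`-commuting pair of unitaries on `𝒬` such that `W_j*` extends `X_j*` and
`W₁ W₂ = W_D`. -/
structure IsCanonicalUnitaryPair {h : IsQCommutingContractivePair q T₁ T₂}
    (M : MinimalUnitaryExtension (adjX h) 𝒬) (W : (𝒬 →L[ℂ] 𝒬) × (𝒬 →L[ℂ] 𝒬)) : Prop where
  unitary₁ : W.1 ∈ unitary (𝒬 →L[ℂ] 𝒬)
  unitary₂ : W.2 ∈ unitary (𝒬 →L[ℂ] 𝒬)
  comm : W.1 * W.2 = (q : ℂ) • (W.2 * W.1)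
  prod : W.1 * W.2 = unitaryD M
  extends₁ : ∀ x, (W.1†) (M.emb x) = M.emb (adjX₁ h x)
  extends₂ : ∀ x, (W.2†) (M.emb x) = M.emb (adjX₂ h x)

theorem existsUnique_canonicalUnitaryPair {h : IsQCommutingContractivePair q T₁ T₂}
    (M : MinimalUnitaryExtension (adjX h) 𝒬) : ∃! W, IsCanonicalUnitaryPair M W := by
  have hq : (q : ℂ) ≠ 0 := Circle.coe_ne_zero q
  have hqs : (starRingEnd ℂ) (q : ℂ) = (q : ℂ)⁻¹ := (Circle.coe_inv_eq_conj q).symm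
  have c1 : adjX₁ h ∘L adjX h = (q : ℂ) • adjX h ∘L adjX₁ h := asymptotic_ext h fun x => by
    simp only [ContinuousLinearMap.comp_apply, smul_apply, adjX_apply, adjX₁_apply]
    rw [← mul_apply_eq_comp (T₁†), h.adj_comm_left, smul_apply, map_smul, mul_apply_eq_comp]
  have c2 : adjX₂ h ∘L adjX h = (q : ℂ)⁻¹ • adjX h ∘L adjX₂ h := asymptotic_ext h fun x => by
    simp only [ContinuousLinearMap.comp_apply, smul_apply, adjX_apply, adjX₂_apply]
    rw [← mul_apply_eq_comp (T₂†), h.adj_comm_right, smul_apply, map_smul, mul_apply_eq_comp]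
  have c21 : adjX₂ h ∘L adjX₁ h = adjX h := asymptotic_ext h fun x => by
    simp only [ContinuousLinearMap.comp_apply, adjX_apply, adjX₁_apply, adjX₂_apply]
    exact congrArg _ (congrArg (fun A : H →L[ℂ] H => A x) h.adj_eq.symm)
  have c12 : adjX₁ h ∘L adjX₂ h = (q : ℂ) • adjX h := asymptotic_ext h fun x => by
    simp only [ContinuousLinearMap.comp_apply, smul_apply, adjX_apply, adjX₁_apply, adjX₂_apply]
    rw [← mul_apply_eq_comp (T₁†), h.adj_comm, smul_apply, map_smul]
  obtain ⟨Y₁, e1, u1, i1⟩ := M.exists_lift _ (Circle.norm_coe q) _ c1 (adjX₁_isometry h)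
  obtain ⟨Y₂, e2, u2, i2⟩ := M.exists_lift _ (norm_inv_q q) _ c2 (adjX₂_isometry h)
  have p21 : Y₂ * Y₁ = M.U := M.lift_unique 1 one_ne_zero
    (by rw [mul_assoc, u1, mul_smul_comm, ← mul_assoc, u2, smul_mul_assoc, smul_smul,
          mul_inv_cancel₀ hq, mul_assoc])
    (by rw [one_smul])
    (fun x => by
      rw [mul_apply_eq_comp, e1, e2, M.extends_op]
      exact congrArg (fun A => M.emb (A x)) c21)
  have p12 : Y₁ * Y₂ = (q : ℂ) • M.U := M.lift_unique 1 one_ne_zero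
    (by rw [mul_assoc, u2, mul_smul_comm, ← mul_assoc, u1, smul_mul_assoc, smul_smul,
          inv_mul_cancel₀ hq, mul_assoc])
    (by rw [one_smul, smul_mul_assoc, mul_smul_comm])
    (fun x => by
      rw [mul_apply_eq_comp, e2, e1, smul_apply, M.extends_op, ← map_smul]
      exact congrArg (fun A => M.emb (A x)) c12)
  have m1 : Y₁ ∈ unitary (𝒬 →L[ℂ] 𝒬) := mem_unitary_of_isometry i1
    (B := (q : ℂ)⁻¹ • (Y₂ * M.U†)) (by
      rw [mul_smul_comm, ← mul_assoc, p12, smul_mul_assoc, smul_smul, inv_mul_cancel₀ hq,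
        M.U_mul_adjoint, one_smul])
  have m2 : Y₂ ∈ unitary (𝒬 →L[ℂ] 𝒬) := mem_unitary_of_isometry i2 (B := Y₁ * M.U†) (by
      rw [← mul_assoc, p21, M.U_mul_adjoint])
  have a12 : Y₁† * Y₂† = M.U† := by
    rw [← p21]; exact (star_mul Y₂ Y₁).symm
  have a21 : Y₂† * Y₁† = (q : ℂ)⁻¹ • M.U† := by
    have h1 : Y₂† * Y₁† = (Y₁ * Y₂)† := (star_mul Y₁ Y₂).symm
    rw [h1, p12, LinearIsometryEquiv.map_smulₛₗ, hqs]
  refine ⟨(Y₁†, Y₂†), ⟨Unitary.star_mem m1, Unitary.star_mem m2, ?_, a12, ?_, ?_⟩, ?_⟩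
  · change Y₁† * Y₂† = (q : ℂ) • (Y₂† * Y₁†)
    rw [a12, a21, smul_smul, mul_inv_cancel₀ hq, one_smul]
  · intro x
    rw [ContinuousLinearMap.adjoint_adjoint, e1]
  · intro x
    rw [ContinuousLinearMap.adjoint_adjoint, e2]
  · rintro ⟨W₁, W₂⟩ ⟨-, -, hc, hp, w1, w2⟩
    change W₁ * W₂ = (q : ℂ) • (W₂ * W₁) at hc
    change W₁ * W₂ = M.U† at hp
    have s21 : W₂† * W₁† = M.U := by
      rw [← ContinuousLinearMap.adjoint_adjoint M.U, ← hp]; exact (star_mul W₁ W₂).symm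
    have s12 : W₁† * W₂† = (q : ℂ) • M.U := by
      have h1 : W₁† * W₂† = (W₂ * W₁)† := (star_mul W₂ W₁).symm
      have h2 : W₂ * W₁ = (q : ℂ)⁻¹ • (W₁ * W₂) := by
        rw [hc, smul_smul, inv_mul_cancel₀ hq, one_smul]
      rw [h1, h2, hp, LinearIsometryEquiv.map_smulₛₗ, ContinuousLinearMap.adjoint_adjoint,
        map_inv₀, hqs, inv_inv]
    have v1 : W₁† * M.U = (q : ℂ) • (M.U * W₁†) := by
      rw [← smul_mul_assoc, ← s12, ← s21, mul_assoc]
    have v2 : W₂† * M.U = (q : ℂ)⁻¹ • (M.U * W₂†) := by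
      rw [← s21, mul_assoc (W₂†) (W₁†), s12, mul_smul_comm, s21, smul_smul, inv_mul_cancel₀ hq,
        one_smul]
    have z1 : W₁† = Y₁ := M.lift_unique _ hq v1 u1 fun x => (w1 x).trans (e1 x).symm
    have z2 : W₂† = Y₂ := M.lift_unique _ (inv_ne_zero hq) v2 u2 fun x => (w2 x).trans (e2 x).symm
    rw [← z1, ← z2, ContinuousLinearMap.adjoint_adjoint, ContinuousLinearMap.adjoint_adjoint]

/-- The canonical `q`-commuting pair of unitaries `(W₁, W₂)` associated with `(T₁, T₂)`. -/
def canonicalUnitaryPair {h : IsQCommutingContractivePair q T₁ T₂}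
    (M : MinimalUnitaryExtension (adjX h) 𝒬) : (𝒬 →L[ℂ] 𝒬) × (𝒬 →L[ℂ] 𝒬) :=
  (existsUnique_canonicalUnitaryPair M).choose

/-! ### Pseudo `q`-commuting contractive lifts -/

/-- `(W₁, W₂, W)` is a pseudo `q`-commuting contractive operator triple. -/
structure IsPseudoTriple {K : Type*} [NormedAddCommGroup K] [InnerProductSpace ℂ K]
    [CompleteSpace K] (q : Circle) (W₁ W₂ W : K →L[ℂ] K) : Prop where
  norm_left : ‖W₁‖ ≤ 1
  norm_right : ‖W₂‖ ≤ 1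
  isometry : ∀ x, ‖W x‖ = ‖x‖
  comm_left : W₁ * W = (q : ℂ) • (W * W₁)
  comm_right : W₂ * W = (starRingEnd ℂ) (q : ℂ) • (W * W₂)
  eq_left : W₁ = (starRingEnd ℂ) (q : ℂ) • (W₂† * W)

/-- `(Φ, W₁, W₂, W)` is a pseudo `q`-commuting contractive lift of `(T₁, T₂)`: the triple
`(W₁, W₂, W)` is a pseudo `q`-commuting contractive triple, `Φ` is an isometric embedding that
intertwines the adjoints of `(T₁, T₂, T₁ T₂)` and `(W₁, W₂, W)`, and the closed span of the spaces
`Wⁿ Ran Φ`, `n ≥ 0`, is everything. -/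
structure IsPseudoLift {K : Type*} [NormedAddCommGroup K] [InnerProductSpace ℂ K]
    [CompleteSpace K] (q : Circle) (T₁ T₂ : H →L[ℂ] H) (Φ : H →L[ℂ] K) (W₁ W₂ W : K →L[ℂ] K) :
    Prop where
  triple : IsPseudoTriple q W₁ W₂ W
  isometry : ∀ x, ‖Φ x‖ = ‖x‖
  intertwine₁ : Φ ∘L T₁† = W₁† ∘L Φ
  intertwine₂ : Φ ∘L T₂† = W₂† ∘L Φ
  intertwine : Φ ∘L (T₂† ∘L T₁†) = W† ∘L Φ
  minimal :
    (Submodule.span ℂ {y : K | ∃ (n : ℕ) (x : H), (W ^ n) (Φ x) = y}).topologicalClosure = ⊤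

/-! ### The Douglas model -/

/-- The block diagonal operator `A ⊕ B` on the Hilbert space direct sum. -/
def blockDiag {K L : Type*} [NormedAddCommGroup K] [InnerProductSpace ℂ K] [NormedAddCommGroup L]
    [InnerProductSpace ℂ L] (A : K →L[ℂ] K) (B : L →L[ℂ] L) :
    WithLp 2 (K × L) →L[ℂ] WithLp 2 (K × L) :=
  ((WithLp.prodContinuousLinearEquiv 2 ℂ K L).symm : _ →L[ℂ] _) ∘L (A.prodMap B) ∘L
    (WithLp.prodContinuousLinearEquiv 2 ℂ K L : _ →L[ℂ] _)

theorem blockDiag_apply {K L : Type*} [NormedAddCommGroup K] [InnerProductSpace ℂ K]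
    [NormedAddCommGroup L] [InnerProductSpace ℂ L] (A : K →L[ℂ] K) (B : L →L[ℂ] L) (x : K)
    (y : L) : blockDiag A B (WithLp.toLp 2 (x, y)) = WithLp.toLp 2 (A x, B y) := rfl

/-- The Douglas model space `𝒦_D = H²(𝒟_{T*}) ⊕ 𝒬`, for `T = T₁ T₂`. -/
abbrev DouglasSpace (T₁ T₂ : H →L[ℂ] H) (𝒬 : Type*) : Type _ :=
  WithLp 2 (Hardy (DefectSpace ((T₁ * T₂)†)) × 𝒬)

/-- The isometry `X*` does have a minimal unitary extension. -/
def exampleExtension (h : IsQCommutingContractivePair q T₁ T₂) :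
    MinimalUnitaryExtension (adjX h)
      (WithLp 2 (AsymptoticSpace h.norm_adj × Hardy ((adjX h)†).ker)) :=
  MinimalUnitaryExtension.ofIsometry (adjX h) (adjX_isometry h)

variable {h : IsQCommutingContractivePair q T₁ T₂} (M : MinimalUnitaryExtension (adjX h) 𝒬)

/-- The Douglas embedding `Π_D x = (∑ zⁿ D_{T*} (T*)ⁿ x, Q_{T*} x)`. -/
def douglasEmb : H →L[ℂ] DouglasSpace T₁ T₂ 𝒬 :=
  ((WithLp.prodContinuousLinearEquiv 2 ℂ (Hardy (DefectSpace ((T₁ * T₂)†))) 𝒬).symm :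
    _ →L[ℂ] DouglasSpace T₁ T₂ 𝒬) ∘L
    ContinuousLinearMap.prod (observability h.norm_adj)
      (M.emb.toContinuousLinearMap ∘L toClosedRange (asymptoticRoot h.norm_adj))

/-- The isometry `V_D = M_z ⊕ W_D`. -/
def douglasV : DouglasSpace T₁ T₂ 𝒬 →L[ℂ] DouglasSpace T₁ T₂ 𝒬 :=
  blockDiag Hardy.shift (unitaryD M)

/-- The operator `M_{G₁* + z G₂} R_q ⊕ W₁`. -/
def douglasW₁ : DouglasSpace T₁ T₂ 𝒬 →L[ℂ] DouglasSpace T₁ T₂ 𝒬 :=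
  blockDiag (Hardy.mulPencil ((fundamentalOps h).1†) (fundamentalOps h).2 ∘L Hardy.rot q)
    (canonicalUnitaryPair M).1

/-- The operator `R_{q̄} M_{G₂* + z G₁} ⊕ W₂`. -/
def douglasW₂ : DouglasSpace T₁ T₂ 𝒬 →L[ℂ] DouglasSpace T₁ T₂ 𝒬 :=
  blockDiag (Hardy.rot q⁻¹ ∘L Hardy.mulPencil ((fundamentalOps h).2†) (fundamentalOps h).1)
    (canonicalUnitaryPair M).2

end Pair

end TwistedPair

end

open TwistedPair

namespace TwistedPair

/-! Everything is computed for the contraction `T* = T₂* T₁*`, using `T₁* T* = q T* T₁*` and `T₂* T*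
= q̄ T* T₂*`.

Existence. The sums of `‖D_{T*} T*ᵏ x‖²` telescope to `‖x‖² - ‖Q_{T*} x‖²`, so `Π_D` is isometric.
The contractivity of the pencils comes from splitting `I - TT*` in two ways, `(I - T₁T₁*) + T₁(I -
T₂T₂*)T₁* = (I - T₂T₂*) + T₂(I - T₁T₁*)T₂*`. These give two isometric columns `(A, B)` and `(C, D)`
on the defect space with `G₁ = C*A` and `G₂ = B*D` (`exists_fundamentalOps_factor`). Hence `G₁* +
zG₂ = A*C + zB*D` is the adjoint of one column times the other column with a shift inserted in its
second entry, and `G₂* + zG₁` has the same shape. The intertwining relations reduce to `D_{T*}T₁* =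
G₁D_{T*} + G₂*D_{T*}T*` and `D_{T*}T₂* = G₂D_{T*} + qG₁*D_{T*}T*` (`defect_adjoint_left`,
`defect_adjoint_right`). Moving `Tⱼ*` past `T*ⁿ` produces the powers of `q` that the rotations
encode. For minimality (`observability_minimal`), a vector orthogonal to all `V_Dⁿ Π_D x` is tested
at `(n + 1, T* x)` and at `(n, x)`. The second summand contributes the same to both, so each Hardy
coefficient vanishes, and the minimality of the unitary extension disposes of the rest.

Uniqueness (`IsPseudoLift.unique`) uses nothing about the model. For two lifts with the same `Π` and
`V`, the differences `A = W₁ - W₁'` and `B = W₂ - W₂'` satisfy `B = A*V`, `B*V = qA` and `BV =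
q̄VB`, while `A*` and `B*` vanish on `Ran Π`. Testing against the total set `VⁿΠx` gives first `BΠ =
0`, then `A = 0`, and so `B = A*V = 0`. -/

theorem conj_mul_circle (q : Circle) : (starRingEnd ℂ) (q : ℂ) * (q : ℂ) = 1 := by
  rw [← Circle.coe_inv_eq_conj, ← Circle.coe_mul, inv_mul_cancel, Circle.coe_one]

/-! ### Adjoints and norms of the basic operators on `H²(E)`. -/

namespace Hardy

section Adjoints

variable {E F : Type*} [NormedAddCommGroup E] [InnerProductSpace ℂ E] [CompleteSpace E]
  [NormedAddCommGroup F] [InnerProductSpace ℂ F] [CompleteSpace F]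

theorem adjoint_ampl (A : E →L[ℂ] F) : (ampl A)† = ampl (A†) := by
  symm
  rw [ContinuousLinearMap.eq_adjoint_iff]
  intro f g
  rw [lp.inner_eq_tsum, lp.inner_eq_tsum]
  simp only [ampl_apply, ContinuousLinearMap.adjoint_inner_left]

theorem adjoint_rot (w : Circle) : (rot w : Hardy E →L[ℂ] Hardy E)† = rot w⁻¹ := by
  symm
  rw [ContinuousLinearMap.eq_adjoint_iff]
  intro f g
  rw [lp.inner_eq_tsum, lp.inner_eq_tsum]
  simp only [rot_apply, inner_smul_left, inner_smul_right, map_pow, Circle.coe_inv_eq_conj,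
    Complex.conj_conj]

theorem adjoint_shift : (shift : Hardy E →L[ℂ] Hardy E)† = backShift := by
  symm
  rw [ContinuousLinearMap.eq_adjoint_iff]
  intro f g
  rw [lp.inner_eq_tsum, lp.inner_eq_tsum, (lp.summable_inner (𝕜 := ℂ) f (shift g)).tsum_eq_zero_add]
  simp only [backShift_apply, shift_zero, shift_succ, inner_zero_right, zero_add]

theorem norm_rot (w : Circle) (f : Hardy E) : ‖rot w f‖ = ‖f‖ := by
  refine (sq_eq_sq₀ (norm_nonneg _) (norm_nonneg _)).1 ?_
  simp only [norm_sq, rot_apply, norm_smul, norm_pow, Circle.norm_coe, one_pow, one_mul]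

theorem norm_shift (f : Hardy E) : ‖shift f‖ = ‖f‖ := by
  refine (sq_eq_sq₀ (norm_nonneg _) (norm_nonneg _)).1 ?_
  rw [norm_sq, norm_sq f, (summable_sq (shift f)).tsum_eq_zero_add]
  simp

/-- An isometric column stays isometric when it acts on every coefficient. -/
theorem norm_sq_ampl_add (A B : E →L[ℂ] F) (hAB : ∀ x, ‖A x‖ ^ 2 + ‖B x‖ ^ 2 = ‖x‖ ^ 2)
    (f : Hardy E) : ‖ampl A f‖ ^ 2 + ‖ampl B f‖ ^ 2 = ‖f‖ ^ 2 := by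
  rw [norm_sq, norm_sq, norm_sq, ← (summable_sq _).tsum_add (summable_sq _)]
  simp only [ampl_apply, hAB]

end Adjoints

end Hardy

/-! ### Contractive linear pencils. -/

section Contraction

variable {E F : Type*} [NormedAddCommGroup E] [InnerProductSpace ℂ E] [CompleteSpace E]
  [NormedAddCommGroup F] [InnerProductSpace ℂ F] [CompleteSpace F]

/-- The operator `A* C + B* D` is a contraction when the columns `(A, B)` and `(C, D)` are. -/
theorem norm_adjoint_add_adjoint_le (A B C D : E →L[ℂ] F)
    (hAB : ∀ x, ‖A x‖ ^ 2 + ‖B x‖ ^ 2 ≤ ‖x‖ ^ 2) (hCD : ∀ x, ‖C x‖ ^ 2 + ‖D x‖ ^ 2 ≤ ‖x‖ ^ 2)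
    (x : E) : ‖(A†) (C x) + (B†) (D x)‖ ≤ ‖x‖ := by
  set y := (A†) (C x) + (B†) (D x) with hy
  have h1 : inner ℂ y y = inner ℂ (A y) (C x) + inner ℂ (B y) (D x) := by
    nth_rw 2 [hy]
    rw [inner_add_right, ContinuousLinearMap.adjoint_inner_right,
      ContinuousLinearMap.adjoint_inner_right]
  have h2 : ‖y‖ ^ 2 ≤ ‖A y‖ * ‖C x‖ + ‖B y‖ * ‖D x‖ := by
    have h3 : ‖y‖ ^ 2 = ‖(inner ℂ y y : ℂ)‖ := by
      rw [inner_self_eq_norm_sq_to_K]; simp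
    rw [h3, h1]
    exact (norm_add_le _ _).trans (add_le_add (norm_inner_le_norm _ _) (norm_inner_le_norm _ _))
  refine le_of_sq_le_sq ?_ (norm_nonneg _)
  -- By the arithmetic-geometric mean inequality the right side of `h2` is at most half of `‖A y‖² +
  -- ‖B y‖² + ‖C x‖² + ‖D x‖²`, hence at most `(‖y‖² + ‖x‖²) / 2`.
  nlinarith [hAB y, hCD x, sq_nonneg (‖A y‖ - ‖C x‖), sq_nonneg (‖B y‖ - ‖D x‖)]

/-- The pencil `A*C + zB*D` factors as the adjoint of the column `(A, B)` times the column `(C,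
zD)`. The factor `z` does not change norms, so both columns are isometric on `H²(E)`. -/
theorem Hardy.norm_mulPencil_le (A B C D : E →L[ℂ] F)
    (hAB : ∀ x, ‖A x‖ ^ 2 + ‖B x‖ ^ 2 = ‖x‖ ^ 2) (hCD : ∀ x, ‖C x‖ ^ 2 + ‖D x‖ ^ 2 = ‖x‖ ^ 2)
    (f : Hardy E) : ‖Hardy.mulPencil (A† ∘L C) (B† ∘L D) f‖ ≤ ‖f‖ := by
  have h1 : Hardy.mulPencil (A† ∘L C) (B† ∘L D) f =
      ((Hardy.ampl A)†) (Hardy.ampl C f) +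
        ((Hardy.ampl B)†) ((Hardy.shift ∘L Hardy.ampl D) f) := by
    rw [Hardy.adjoint_ampl, Hardy.adjoint_ampl]
    ext n
    cases n with
    -- The shift acts after `B†` in the pencil and before it in the factorization; the two orders
    -- differ, as terms, only at coefficient zero.
    | zero =>
      change (A†) (C (f 0)) + 0 = (A†) (C (f 0)) + (B†) 0
      rw [map_zero]
    | succ n => rfl
  rw [h1]
  refine norm_adjoint_add_adjoint_le _ _ _ _ (fun x => (Hardy.norm_sq_ampl_add A B hAB x).le)
    (fun x => ?_) f
  rw [ContinuousLinearMap.comp_apply, Hardy.norm_shift]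
  exact (Hardy.norm_sq_ampl_add C D hCD x).le

end Contraction

/-! ### Block diagonal operators. -/

section BlockDiag

variable {K L : Type*} [NormedAddCommGroup K] [InnerProductSpace ℂ K] [NormedAddCommGroup L]
  [InnerProductSpace ℂ L]

theorem blockDiag_mul (A A' : K →L[ℂ] K) (B B' : L →L[ℂ] L) :
    blockDiag A B * blockDiag A' B' = blockDiag (A * A') (B * B') := rfl

theorem smul_blockDiag (c : ℂ) (A : K →L[ℂ] K) (B : L →L[ℂ] L) :
    c • blockDiag A B = blockDiag (c • A) (c • B) := rfl

theorem adjoint_blockDiag [CompleteSpace K] [CompleteSpace L] (A : K →L[ℂ] K) (B : L →L[ℂ] L) :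
    (blockDiag A B)† = blockDiag (A†) (B†) := by
  symm
  rw [ContinuousLinearMap.eq_adjoint_iff]
  intro x y
  rw [WithLp.prod_inner_apply, WithLp.prod_inner_apply]
  change inner ℂ ((A†) x.fst) y.fst + inner ℂ ((B†) x.snd) y.snd =
    inner ℂ x.fst (A y.fst) + inner ℂ x.snd (B y.snd)
  rw [ContinuousLinearMap.adjoint_inner_left, ContinuousLinearMap.adjoint_inner_left]

theorem norm_sq_blockDiag_apply (A : K →L[ℂ] K) (B : L →L[ℂ] L) (x : WithLp 2 (K × L)) :
    ‖blockDiag A B x‖ ^ 2 = ‖A x.fst‖ ^ 2 + ‖B x.snd‖ ^ 2 :=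
  WithLp.prod_norm_sq_eq_of_L2 _

theorem norm_blockDiag_le_one {A : K →L[ℂ] K} {B : L →L[ℂ] L} (hA : ∀ x, ‖A x‖ ≤ ‖x‖)
    (hB : ∀ y, ‖B y‖ ≤ ‖y‖) : ‖blockDiag A B‖ ≤ 1 := by
  refine ContinuousLinearMap.opNorm_le_bound _ zero_le_one fun x => ?_
  rw [one_mul]
  refine le_of_sq_le_sq ?_ (norm_nonneg _)
  rw [norm_sq_blockDiag_apply, WithLp.prod_norm_sq_eq_of_L2]
  exact add_le_add (pow_le_pow_left₀ (norm_nonneg _) (hA _) 2)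
    (pow_le_pow_left₀ (norm_nonneg _) (hB _) 2)

theorem norm_blockDiag_apply {A : K →L[ℂ] K} {B : L →L[ℂ] L} (hA : ∀ x, ‖A x‖ = ‖x‖)
    (hB : ∀ y, ‖B y‖ = ‖y‖) (x : WithLp 2 (K × L)) : ‖blockDiag A B x‖ = ‖x‖ := by
  refine (sq_eq_sq₀ (norm_nonneg _) (norm_nonneg _)).1 ?_
  rw [norm_sq_blockDiag_apply, WithLp.prod_norm_sq_eq_of_L2, hA, hB]

end BlockDiag

/-! ### Fundamental operators: factorization and intertwining identities. -/

section Pair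

variable {H : Type*} [NormedAddCommGroup H] [InnerProductSpace ℂ H] [CompleteSpace H]
  {q : Circle} {T₁ T₂ : H →L[ℂ] H}

/-- A self-adjoint operator is injective on the closure of its range. Identities in the defect space
can therefore be checked after applying `D_T`, which is where the fundamental equations live. -/
theorem defectOp_injective_on_defectSpace {T : H →L[ℂ] H} {y z : DefectSpace T}
    (hyz : defectOp T y = defectOp T z) : y = z := by
  refine ext_inner_right ℂ fun w => ?_
  refine (denseRange_toClosedRange (defectOp T)).induction_on w
    (isClosed_eq (by fun_prop) (by fun_prop)) fun x => ?_
  rw [← inner_toClosedRange (isSelfAdjoint_defectOp T), hyz,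
    inner_toClosedRange (isSelfAdjoint_defectOp T)]

theorem isFundamentalPair (h : IsQCommutingContractivePair q T₁ T₂) :
    IsFundamentalPair q T₁ T₂ (fundamentalOps h) :=
  (existsUnique_fundamentalPair h).choose_spec.1

theorem defectOp_adjoint_sq_apply {T : H →L[ℂ] H} (hT : ‖T†‖ ≤ 1) (x : H) :
    defectOp (T†) (defectOp (T†) x) = x - T ((T†) x) := by
  rw [← mul_apply_eq_comp, defectOp_mul_self hT, ContinuousLinearMap.adjoint_adjoint]
  rfl

/-- The solution of `D_{T*} G D_{T*} = (I - S S*) R*` is `C* A`, where `A D_{T*} = D_{S*} R*` and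
`C D_{T*} = D_{S*}`. -/
theorem eq_adjoint_comp_of_factor {T S R : H →L[ℂ] H} (hS : ‖S†‖ ≤ 1)
    {G : DefectSpace T →L[ℂ] DefectSpace T}
    (hG : ∀ x, defectOp T (G (toClosedRange (defectOp T) x)) = (R†) x - S ((S†) ((R†) x)))
    {A C : DefectSpace T →L[ℂ] H}
    (hA : ∀ x, A (toClosedRange (defectOp T) x) = defectOp (S†) ((R†) x))
    (hC : ∀ x, C (toClosedRange (defectOp T) x) = defectOp (S†) x) : G = C† ∘L A := by
  refine fundamental_unique (isSelfAdjoint_defectOp T) fun x => ext_inner_right ℂ fun y => ?_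
  rw [hG, inner_toClosedRange (isSelfAdjoint_defectOp T), ContinuousLinearMap.comp_apply,
    ContinuousLinearMap.adjoint_inner_left, hA, hC]
  rw [← ContinuousLinearMap.adjoint_inner_left, isSelfAdjoint_defectOp,
    defectOp_adjoint_sq_apply hS]

/-- Operators that complement each other on the range of `D_T` factor through the defect space of
`T`, by a pair forming an isometric column. -/
theorem exists_isometric_column {T A B : H →L[ℂ] H}
    (hAB : ∀ x, ‖A x‖ ^ 2 + ‖B x‖ ^ 2 = ‖defectOp T x‖ ^ 2) :
    ∃ A' B' : DefectSpace T →L[ℂ] H, (∀ x, A' (toClosedRange (defectOp T) x) = A x) ∧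
      (∀ x, B' (toClosedRange (defectOp T) x) = B x) ∧ ∀ y, ‖A' y‖ ^ 2 + ‖B' y‖ ^ 2 = ‖y‖ ^ 2 := by
  obtain ⟨A', hA⟩ := exists_factor (A := defectOp T) (B := A)
    fun x => le_of_sq_le_sq ((le_add_of_nonneg_right (sq_nonneg _)).trans_eq (hAB x))
      (norm_nonneg _)
  obtain ⟨B', hB⟩ := exists_factor (A := defectOp T) (B := B)
    fun x => le_of_sq_le_sq ((le_add_of_nonneg_left (sq_nonneg _)).trans_eq (hAB x)) (norm_nonneg _)
  refine ⟨A', B', hA, hB, fun y => ?_⟩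
  refine (denseRange_toClosedRange (defectOp T)).induction_on y
    (isClosed_eq (by fun_prop) (by fun_prop)) fun x => ?_
  rw [hA, hB]
  exact hAB x

/-- A factorization of the fundamental operators through the defect operators of `T₁*`, `T₂*`. -/
theorem exists_fundamentalOps_factor (h : IsQCommutingContractivePair q T₁ T₂) :
    ∃ A B C D : DefectSpace ((T₁ * T₂)†) →L[ℂ] H,
      (fundamentalOps h).1 = C† ∘L A ∧ (fundamentalOps h).2 = B† ∘L D ∧
        (∀ y, ‖A y‖ ^ 2 + ‖B y‖ ^ 2 = ‖y‖ ^ 2) ∧ ∀ y, ‖C y‖ ^ 2 + ‖D y‖ ^ 2 = ‖y‖ ^ 2 := by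
  have hl := norm_adjoint_le_one h.norm_left
  have hr := norm_adjoint_le_one h.norm_right
  have e1 : ∀ x, ((T₁ * T₂)†) x = (T₂†) ((T₁†) x) := fun x => by
    rw [h.adj_eq, mul_apply_eq_comp]
  have e2 : ∀ x, (T₁†) ((T₂†) x) = (q : ℂ) • ((T₁ * T₂)†) x := fun x => by
    rw [← mul_apply_eq_comp, h.adj_comm, smul_apply]
  -- Quadratic form of `I - TT* = T₁(I - T₂T₂*)T₁* + (I - T₁T₁*)`. In `n2` the indices are
  -- exchanged, which is allowed because `T₂T₁` and `T₁T₂` differ by a unimodular factor.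
  have n1 : ∀ x, ‖(defectOp (T₂†) * T₁†) x‖ ^ 2 + ‖defectOp (T₁†) x‖ ^ 2 =
      ‖defectOp ((T₁ * T₂)†) x‖ ^ 2 := fun x => by
    rw [mul_apply_eq_comp, norm_defectOp_sq hl, norm_defectOp_sq hr, norm_defectOp_sq h.norm_adj,
      e1]
    ring
  have n2 : ∀ x, ‖defectOp (T₂†) x‖ ^ 2 + ‖(defectOp (T₁†) * T₂†) x‖ ^ 2 =
      ‖defectOp ((T₁ * T₂)†) x‖ ^ 2 := fun x => by
    rw [mul_apply_eq_comp, norm_defectOp_sq hl, norm_defectOp_sq hr, norm_defectOp_sq h.norm_adj,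
      e2, norm_smul, Circle.norm_coe]
    ring
  obtain ⟨A, B, hA, hB, hAB⟩ := exists_isometric_column n1
  obtain ⟨C, D, hC, hD, hCD⟩ := exists_isometric_column n2
  -- The right sides of the fundamental equations are `(I - T₂T₂*)T₁*` and `(I - T₁T₁*)T₂*`, since
  -- `T* = T₂*T₁*` and `qT* = T₁*T₂*`.
  exact ⟨A, B, C, D,
    eq_adjoint_comp_of_factor hr (fun x => by rw [(isFundamentalPair h).left, e1]) hA hC,
    eq_adjoint_comp_of_factor hl
      (fun x => by rw [(isFundamentalPair h).right, e2, map_smul]) hD hB, hAB, hCD⟩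

theorem Hardy.norm_mulPencil_adjoint_le {E F : Type*} [NormedAddCommGroup E]
    [InnerProductSpace ℂ E] [CompleteSpace E] [NormedAddCommGroup F] [InnerProductSpace ℂ F]
    [CompleteSpace F] {A B C D : E →L[ℂ] F} {G G' : E →L[ℂ] E} (hG : G = C† ∘L A)
    (hG' : G' = B† ∘L D) (hAB : ∀ x, ‖A x‖ ^ 2 + ‖B x‖ ^ 2 = ‖x‖ ^ 2)
    (hCD : ∀ x, ‖C x‖ ^ 2 + ‖D x‖ ^ 2 = ‖x‖ ^ 2) (f : Hardy E) :
    ‖Hardy.mulPencil (G†) G' f‖ ≤ ‖f‖ := by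
  rw [hG, hG', ContinuousLinearMap.adjoint_comp, ContinuousLinearMap.adjoint_adjoint]
  exact Hardy.norm_mulPencil_le A B C D hAB hCD f

theorem norm_mulPencil_fundamentalOps_left_le (h : IsQCommutingContractivePair q T₁ T₂)
    (f : Hardy (DefectSpace ((T₁ * T₂)†))) :
    ‖Hardy.mulPencil ((fundamentalOps h).1†) (fundamentalOps h).2 f‖ ≤ ‖f‖ := by
  obtain ⟨A, B, C, D, h1, h2, hAB, hCD⟩ := exists_fundamentalOps_factor h
  exact Hardy.norm_mulPencil_adjoint_le h1 h2 hAB hCD f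

theorem norm_mulPencil_fundamentalOps_right_le (h : IsQCommutingContractivePair q T₁ T₂)
    (f : Hardy (DefectSpace ((T₁ * T₂)†))) :
    ‖Hardy.mulPencil ((fundamentalOps h).2†) (fundamentalOps h).1 f‖ ≤ ‖f‖ := by
  obtain ⟨A, B, C, D, h1, h2, hAB, hCD⟩ := exists_fundamentalOps_factor h
  -- Here `G₂* + zG₁ = D*B + zC*A`, so the relevant columns are `(D, C)` and `(B, A)`.
  exact Hardy.norm_mulPencil_adjoint_le h2 h1 (fun y => by rw [add_comm, hCD])
    (fun y => by rw [add_comm, hAB]) f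

/-- `D G* (D y) = (D G D)* y`, expressed through a formula for `D G D`. -/
theorem defectOp_adjoint_apply {T R : H →L[ℂ] H} {G : DefectSpace T →L[ℂ] DefectSpace T}
    (hG : ∀ x, defectOp T (G (toClosedRange (defectOp T) x)) = R x) (x : H) :
    defectOp T ((G†) (toClosedRange (defectOp T) x)) = (R†) x := by
  refine ext_inner_right ℂ fun y => ?_
  rw [inner_toClosedRange (isSelfAdjoint_defectOp T), ContinuousLinearMap.adjoint_inner_left,
    ContinuousLinearMap.adjoint_inner_left, ← hG, ← inner_conj_symm,
    ← inner_toClosedRange (isSelfAdjoint_defectOp T), inner_conj_symm]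

/-- After applying `D_{T*}`, the right side becomes `(T₁* - T₂T*) + (T₂ - q̄TT₁*)T*`. The terms
`T₂T*` cancel, and `q̄TT₁*T* = TT*T₁*` leaves `(I - TT*)T₁*`. -/
theorem defect_adjoint_left (h : IsQCommutingContractivePair q T₁ T₂) (x : H) :
    toClosedRange (defectOp ((T₁ * T₂)†)) ((T₁†) x) =
      (fundamentalOps h).1 (toClosedRange (defectOp ((T₁ * T₂)†)) x) +
        ((fundamentalOps h).2†) (toClosedRange (defectOp ((T₁ * T₂)†)) (((T₁ * T₂)†) x)) := by
  have hG := isFundamentalPair h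
  have h2 := defectOp_adjoint_apply (R := T₂† - (q : ℂ) • (T₁ * (T₁ * T₂)†)) hG.right
  have h3 : (T₂† - (q : ℂ) • (T₁ * (T₁ * T₂)†))† =
      T₂ - (starRingEnd ℂ) (q : ℂ) • ((T₁ * T₂) * T₁†) := by
    rw [map_sub, LinearIsometryEquiv.map_smulₛₗ, ContinuousLinearMap.adjoint_adjoint]
    congr 2
    refine (star_mul T₁ ((T₁ * T₂)†)).trans ?_
    rw [ContinuousLinearMap.star_eq_adjoint, ContinuousLinearMap.star_eq_adjoint,
      ContinuousLinearMap.adjoint_adjoint]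
  have h4 := congrArg (fun A : H →L[ℂ] H => (T₁ * T₂) (A x)) h.adj_comm_left
  simp only [mul_apply_eq_comp (T₁†), smul_apply, map_smul] at h4
  refine defectOp_injective_on_defectSpace ?_
  rw [Submodule.coe_add, map_add, hG.left, h2, h3, coe_toClosedRange,
    defectOp_adjoint_sq_apply h.norm_adj, sub_apply, smul_apply, mul_apply_eq_comp (T₁ * T₂), h4,
    smul_smul, ← Complex.normSq_eq_conj_mul_self]
  simp

/-- After applying `D_{T*}`, the right side becomes `(T₂* - qT₁T*) + q(T₁ - TT₂*)T*`. The factor `q`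
is what cancels `qT₁T*` and turns `qTT₂*T*` into `TT*T₂*`. -/
theorem defect_adjoint_right (h : IsQCommutingContractivePair q T₁ T₂) (x : H) :
    toClosedRange (defectOp ((T₁ * T₂)†)) ((T₂†) x) =
      (fundamentalOps h).2 (toClosedRange (defectOp ((T₁ * T₂)†)) x) +
        (q : ℂ) • ((fundamentalOps h).1†)
          (toClosedRange (defectOp ((T₁ * T₂)†)) (((T₁ * T₂)†) x)) := by
  have hG := isFundamentalPair h
  have h2 := defectOp_adjoint_apply (R := T₁† - T₂ * (T₁ * T₂)†) hG.left
  have h3 : (T₁† - T₂ * (T₁ * T₂)†)† = T₁ - (T₁ * T₂) * T₂† := by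
    rw [map_sub, ContinuousLinearMap.adjoint_adjoint]
    congr 1
    refine (star_mul T₂ ((T₁ * T₂)†)).trans ?_
    rw [ContinuousLinearMap.star_eq_adjoint, ContinuousLinearMap.star_eq_adjoint,
      ContinuousLinearMap.adjoint_adjoint]
  have h4 := congrArg (fun A : H →L[ℂ] H => (T₁ * T₂) (A x)) h.adj_comm_right
  simp only [mul_apply_eq_comp (T₂†), smul_apply, map_smul] at h4
  refine defectOp_injective_on_defectSpace ?_
  rw [Submodule.coe_add, map_add, hG.right, Submodule.coe_smul, map_smul, h2, h3,
    coe_toClosedRange, defectOp_adjoint_sq_apply h.norm_adj, sub_apply,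
    mul_apply_eq_comp (T₁ * T₂) (T₂†), h4, smul_sub, smul_smul,
    mul_inv_cancel₀ (Circle.coe_ne_zero q)]
  simp

end Pair

/-! ### Pencils, rotations and the shift. -/

namespace Hardy

section Pencil

variable {E : Type*} [NormedAddCommGroup E] [InnerProductSpace ℂ E]

@[simp] theorem mulPencil_apply_zero (A B : E →L[ℂ] E) (f : Hardy E) :
    mulPencil A B f 0 = A (f 0) := by
  change A (f 0) + 0 = _
  rw [add_zero]

@[simp] theorem mulPencil_apply_succ (A B : E →L[ℂ] E) (f : Hardy E) (n : ℕ) :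
    mulPencil A B f (n + 1) = A (f (n + 1)) + B (f n) := rfl

theorem mulPencil_mul_shift (A B : E →L[ℂ] E) :
    mulPencil A B * shift = shift * mulPencil A B := by
  ext f n
  -- Coefficient one is separate because there the `B` term meets the zero coefficient of the
  -- shifted function.
  rcases n with _ | _ | n
  · simp [mul_apply_eq_comp]
  · simp [mul_apply_eq_comp]
  · simp [mul_apply_eq_comp]

/-- Rotation replaces the factor `z` by `wz`. This is the only source of the twist in the model's
commutation relations on the Hardy summand. -/
theorem rot_mul_shift (w : Circle) :
    (rot w * shift : Hardy E →L[ℂ] Hardy E) = (w : ℂ) • (shift * rot w) := by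
  ext f n
  cases n with
  | zero => simp [mul_apply_eq_comp]
  | succ n => simp [mul_apply_eq_comp, pow_succ', smul_smul]

theorem mulPencil_rot_mul_shift (w : Circle) (A B : E →L[ℂ] E) :
    (mulPencil A B ∘L rot w) * shift = (w : ℂ) • (shift * (mulPencil A B ∘L rot w)) := by
  change mulPencil A B * rot w * shift = _ • (shift * (mulPencil A B * rot w))
  rw [mul_assoc, rot_mul_shift, mul_smul_comm, ← mul_assoc, mulPencil_mul_shift, mul_assoc]

theorem rot_mulPencil_mul_shift (w : Circle) (A B : E →L[ℂ] E) :
    (rot w ∘L mulPencil A B) * shift = (w : ℂ) • (shift * (rot w ∘L mulPencil A B)) := by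
  change rot w * mulPencil A B * shift = _ • (shift * (rot w * mulPencil A B))
  rw [mul_assoc, mulPencil_mul_shift, ← mul_assoc, rot_mul_shift, smul_mul_assoc, mul_assoc]

variable [CompleteSpace E]

theorem adjoint_mulPencil (A B : E →L[ℂ] E) :
    (mulPencil A B)† = ampl (A†) + ampl (B†) ∘L backShift := by
  rw [mulPencil, map_add, ContinuousLinearMap.adjoint_comp, adjoint_ampl, adjoint_ampl,
    adjoint_shift]

theorem adjoint_mulPencil_rot_apply (w : Circle) (A B : E →L[ℂ] E) (f : Hardy E) (n : ℕ) :
    ((mulPencil A B ∘L rot w)†) f n =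
      ((w⁻¹ : Circle) : ℂ) ^ n • ((A†) (f n) + (B†) (f (n + 1))) := by
  rw [ContinuousLinearMap.adjoint_comp, adjoint_rot, adjoint_mulPencil]
  rfl

theorem adjoint_rot_mulPencil_apply (w : Circle) (A B : E →L[ℂ] E) (f : Hardy E) (n : ℕ) :
    ((rot w⁻¹ ∘L mulPencil A B)†) f n =
      (w : ℂ) ^ n • (A†) (f n) + (w : ℂ) ^ (n + 1) • (B†) (f (n + 1)) := by
  rw [ContinuousLinearMap.adjoint_comp, adjoint_rot, adjoint_mulPencil, inv_inv,
    ← map_smul, ← map_smul]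
  rfl

/-- Since `M_z* M_z = I`, one has `(M_{B*+zA})* M_z = M_{A*+zB}`. The adjoint rotation is passed
through `M_z` at the price of a factor `w`, which the conjugate constant removes. -/
theorem mulPencil_rot_eq (w : Circle) (A B : E →L[ℂ] E) :
    mulPencil (A†) B ∘L rot w =
      (starRingEnd ℂ) (w : ℂ) • (((rot w⁻¹ ∘L mulPencil (B†) A)†) * shift) := by
  ext f n
  have hw := conj_mul_circle w
  rw [smul_apply, mul_apply_eq_comp, lp.coeFn_smul, Pi.smul_apply, adjoint_rot_mulPencil_apply,
    ContinuousLinearMap.adjoint_adjoint, shift_succ, smul_add, smul_smul, smul_smul, pow_succ',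
    ← mul_assoc, hw, one_mul, ContinuousLinearMap.comp_apply]
  cases n with
  | zero => simp
  | succ n =>
    rw [shift_succ, pow_succ', ← mul_assoc, hw, one_mul, mulPencil_apply_succ, rot_apply, rot_apply,
      map_smul, map_smul, pow_succ', add_comm]

end Pencil

end Hardy

/-! ### Uniqueness of pseudo lifts. -/

section Uniqueness

variable {H K : Type*} [NormedAddCommGroup H] [InnerProductSpace ℂ H] [CompleteSpace H]
  [NormedAddCommGroup K] [InnerProductSpace ℂ K] [CompleteSpace K]
  {q : Circle} {T₁ T₂ : H →L[ℂ] H} {Φ : H →L[ℂ] K} {W₁ W₂ W₁' W₂' W : K →L[ℂ] K}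

/-- Taking adjoints in `W₁ = q̄W₂*W` gives `W₁* = qW*W₂`. Then `W₁*W = qW*W₂W = W*WW₂ = W₂`. -/
theorem IsPseudoTriple.eq_right (h : IsPseudoTriple q W₁ W₂ W) : W₂ = W₁† * W := by
  have hW : W† * W = 1 := adjoint_mul_self_of_isometry h.isometry
  have h1 : W₁† = (q : ℂ) • (W† * W₂) := by
    have h2 : (W₂† * W)† = W† * W₂ := by
      refine (star_mul (W₂†) W).trans ?_
      rw [ContinuousLinearMap.star_eq_adjoint, ContinuousLinearMap.star_eq_adjoint,
        ContinuousLinearMap.adjoint_adjoint]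
    nth_rw 1 [h.eq_left]
    rw [LinearIsometryEquiv.map_smulₛₗ, h2, Complex.conj_conj]
  rw [h1, smul_mul_assoc, mul_assoc, h.comm_right, mul_smul_comm, smul_smul, mul_comm (q : ℂ),
    conj_mul_circle, one_smul, ← mul_assoc, hW, one_mul]

theorem mul_pow_of_twisted {A W : K →L[ℂ] K} {c : ℂ} (h : A * W = c • (W * A)) (n : ℕ) :
    A * W ^ n = c ^ n • (W ^ n * A) := by
  induction n with
  | zero => simp
  | succ n ih =>
    rw [pow_succ, ← mul_assoc, ih, smul_mul_assoc, mul_assoc, h, mul_smul_comm, smul_smul,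
      ← mul_assoc, pow_succ]

theorem eq_zero_of_inner_minimal (hmin :
      (Submodule.span ℂ {y : K | ∃ (n : ℕ) (x : H), (W ^ n) (Φ x) = y}).topologicalClosure = ⊤)
    {z : K} (hz : ∀ n x, inner ℂ ((W ^ n) (Φ x)) z = 0) : z = 0 := by
  rw [Submodule.topologicalClosure_eq_top_iff, Submodule.eq_bot_iff] at hmin
  refine hmin z ((Submodule.mem_orthogonal _ _).2 fun u hu => ?_)
  induction hu using Submodule.span_induction with
  | mem u hu => obtain ⟨n, x, rfl⟩ := hu; exact hz n x
  | zero => exact inner_zero_left _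
  | add u v _ _ hu hv => rw [inner_add_left, hu, hv, add_zero]
  | smul c u _ hu => rw [inner_smul_left, hu, mul_zero]

/-- The operators `W₁`, `W₂` of a pseudo `q`-commuting contractive lift are determined by the
embedding and the isometry. -/
theorem IsPseudoLift.unique (h : IsPseudoLift q T₁ T₂ Φ W₁ W₂ W)
    (h' : IsPseudoLift q T₁ T₂ Φ W₁' W₂' W) : W₁ = W₁' ∧ W₂ = W₂' := by
  set A := W₁ - W₁' with hA
  set B := W₂ - W₂' with hB
  have hAW : A * W = (q : ℂ) • (W * A) := by
    rw [hA, sub_mul, mul_sub, smul_sub, h.triple.comm_left, h'.triple.comm_left]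
  have hBW : B * W = (starRingEnd ℂ) (q : ℂ) • (W * B) := by
    rw [hB, sub_mul, mul_sub, smul_sub, h.triple.comm_right, h'.triple.comm_right]
  have hBA : B = A† * W := by
    rw [hA, hB, map_sub, sub_mul, ← h.triple.eq_right, ← h'.triple.eq_right]
  have hAB : B† * W = (q : ℂ) • A := by
    have h1 : A = (starRingEnd ℂ) (q : ℂ) • (B† * W) := by
      rw [hA, hB, map_sub, sub_mul, smul_sub, ← h.triple.eq_left, ← h'.triple.eq_left]
    rw [h1, smul_smul, mul_comm (q : ℂ), conj_mul_circle, one_smul]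
  have hAΦ : ∀ x, (A†) (Φ x) = 0 := fun x => by
    have h1 := congrArg (fun S : H →L[ℂ] K => S x) (h.intertwine₁.symm.trans h'.intertwine₁)
    rw [hA, map_sub, sub_apply, sub_eq_zero]
    exact h1
  have hBΦ : ∀ x, (B†) (Φ x) = 0 := fun x => by
    have h1 := congrArg (fun S : H →L[ℂ] K => S x) (h.intertwine₂.symm.trans h'.intertwine₂)
    rw [hB, map_sub, sub_apply, sub_eq_zero]
    exact h1
  -- For positive powers, `B*W = qA` moves the problem to `A* Φ y`, which is zero; for the power
  -- zero, `B* Φ x = 0` suffices.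
  have hB0 : ∀ y, B (Φ y) = 0 := fun y => eq_zero_of_inner_minimal h.minimal fun n x => by
    rw [← ContinuousLinearMap.adjoint_inner_left]
    cases n with
    | zero => rw [pow_zero, one_apply_eq_self, hBΦ, inner_zero_left]
    | succ n =>
      rw [pow_succ', mul_apply_eq_comp, ← mul_apply_eq_comp (B†), hAB, smul_apply,
        inner_smul_left, ← ContinuousLinearMap.adjoint_inner_right, hAΦ, inner_zero_right, mul_zero]
  -- For positive powers, `A*Wⁿ⁺¹Φx = BWⁿΦx = q̄ⁿWⁿBΦx = 0`; for the power zero, `A* Φ x = 0`.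
  have hA1 : A = 0 := by
    ext1 z
    refine eq_zero_of_inner_minimal h.minimal fun n x => ?_
    rw [← ContinuousLinearMap.adjoint_inner_left]
    cases n with
    | zero => rw [pow_zero, one_apply_eq_self, hAΦ, inner_zero_left]
    | succ n =>
      rw [pow_succ', mul_apply_eq_comp, ← mul_apply_eq_comp (A†), ← hBA, ← mul_apply_eq_comp B,
        mul_pow_of_twisted hBW, smul_apply, mul_apply_eq_comp, hB0, map_zero, smul_zero,
        inner_zero_left]
  refine ⟨sub_eq_zero.1 hA1, sub_eq_zero.1 ?_⟩
  rw [← hB, hBA, hA1, map_zero, zero_mul]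

end Uniqueness

/-! ### Pseudo triples: direct sums and the Hardy space model. -/

section PseudoTriple

variable {K L : Type*} [NormedAddCommGroup K] [InnerProductSpace ℂ K] [CompleteSpace K]
  [NormedAddCommGroup L] [InnerProductSpace ℂ L] [CompleteSpace L] {q : Circle}

theorem IsPseudoTriple.blockDiag {A₁ A₂ A : K →L[ℂ] K} {B₁ B₂ B : L →L[ℂ] L}
    (hA : IsPseudoTriple q A₁ A₂ A) (hB : IsPseudoTriple q B₁ B₂ B) :
    IsPseudoTriple q (blockDiag A₁ B₁) (blockDiag A₂ B₂) (blockDiag A B) where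
  norm_left := norm_blockDiag_le_one (norm_apply_le_of_contraction hA.norm_left)
    (norm_apply_le_of_contraction hB.norm_left)
  norm_right := norm_blockDiag_le_one (norm_apply_le_of_contraction hA.norm_right)
    (norm_apply_le_of_contraction hB.norm_right)
  isometry := norm_blockDiag_apply hA.isometry hB.isometry
  comm_left := by
    rw [blockDiag_mul, blockDiag_mul, smul_blockDiag, hA.comm_left, hB.comm_left]
  comm_right := by
    rw [blockDiag_mul, blockDiag_mul, smul_blockDiag, hA.comm_right, hB.comm_right]
  eq_left := by
    rw [adjoint_blockDiag, blockDiag_mul, smul_blockDiag, ← hA.eq_left, ← hB.eq_left]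

/-- The algebraic relations hold for arbitrary coefficients of the pencils; only contractivity of
the two operators needs the bounds, since rotations are isometric. -/
theorem Hardy.isPseudoTriple_mulPencil {E : Type*} [NormedAddCommGroup E] [InnerProductSpace ℂ E]
    [CompleteSpace E] {A B : E →L[ℂ] E} (hl : ∀ f, ‖Hardy.mulPencil (A†) B f‖ ≤ ‖f‖)
    (hr : ∀ f, ‖Hardy.mulPencil (B†) A f‖ ≤ ‖f‖) :
    IsPseudoTriple q (Hardy.mulPencil (A†) B ∘L Hardy.rot q)
      (Hardy.rot q⁻¹ ∘L Hardy.mulPencil (B†) A) Hardy.shift where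
  norm_left := ContinuousLinearMap.opNorm_le_bound _ zero_le_one fun f => by
    rw [one_mul]
    exact (hl _).trans_eq (Hardy.norm_rot q f)
  norm_right := ContinuousLinearMap.opNorm_le_bound _ zero_le_one fun f => by
    rw [one_mul]
    exact (Hardy.norm_rot q⁻¹ _).trans_le (hr f)
  isometry := Hardy.norm_shift
  comm_left := Hardy.mulPencil_rot_mul_shift _ _ _
  comm_right := by
    rw [← Circle.coe_inv_eq_conj]
    exact Hardy.rot_mulPencil_mul_shift _ _ _
  eq_left := Hardy.mulPencil_rot_eq _ _ _

end PseudoTriple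

/-! ### The observability operator: intertwining, norm and cyclicity. -/

section Observability

variable {H : Type*} [NormedAddCommGroup H] [InnerProductSpace ℂ H] [CompleteSpace H]
  {T : H →L[ℂ] H}

theorem eq_zero_of_inner_toClosedRange {A : H →L[ℂ] H} {z : closedRange A}
    (hz : ∀ x, inner ℂ (toClosedRange A x) z = 0) : z = 0 := by
  refine ext_inner_left ℂ fun w => ?_
  refine (denseRange_toClosedRange A).induction_on w
    (isClosed_eq (by fun_prop) (by fun_prop)) fun x => ?_
  rw [hz, inner_zero_right]

/-- Moving `R` to the left of `Tⁿ` costs `c⁻ⁿ`; the identity for `D_T R` is then used at the vector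
`Tⁿ x`. -/
theorem observability_twisted_apply (hT : ‖T‖ ≤ 1) {R : H →L[ℂ] H} {c : ℂ} (hc : c ≠ 0)
    (hR : R * T = c • (T * R)) {G G' : DefectSpace T →L[ℂ] DefectSpace T}
    (hG : ∀ x, toClosedRange (defectOp T) (R x) = G (toClosedRange (defectOp T) x) +
      G' (toClosedRange (defectOp T) (T x))) (x : H) (n : ℕ) :
    observability hT (R x) n =
      c⁻¹ ^ n • (G (observability hT x n) + G' (observability hT x (n + 1))) := by
  have h1 : (T ^ n) (R x) = c⁻¹ ^ n • R ((T ^ n) x) := by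
    have h2 := congrArg (fun A : H →L[ℂ] H => A x) (mul_pow_of_twisted hR n)
    simp only [mul_apply_eq_comp, smul_apply] at h2
    rw [h2, smul_smul, ← mul_pow, inv_mul_cancel₀ hc, one_pow, one_smul]
  rw [observability_apply, observability_apply, observability_apply, h1, map_smul, hG, pow_succ' T,
    mul_apply_eq_comp]

theorem observability_eq_adjoint_mulPencil_rot (hT : ‖T‖ ≤ 1) {R : H →L[ℂ] H} {w : Circle}
    (hR : R * T = (w : ℂ) • (T * R)) {G G' : DefectSpace T →L[ℂ] DefectSpace T}
    (hG : ∀ x, toClosedRange (defectOp T) (R x) = G (toClosedRange (defectOp T) x) +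
      (G'†) (toClosedRange (defectOp T) (T x))) (x : H) :
    observability hT (R x) =
      ((Hardy.mulPencil (G†) G' ∘L Hardy.rot w)†) (observability hT x) := by
  refine lp.ext (funext fun n => ?_)
  rw [observability_twisted_apply hT (Circle.coe_ne_zero w) hR hG,
    Hardy.adjoint_mulPencil_rot_apply, Circle.coe_inv, ContinuousLinearMap.adjoint_adjoint]

/-- When the rotation is applied after the pencil, its adjoint acts before the backward shift, so
coefficient `n + 1` carries `wⁿ⁺¹`. This accounts for the extra `w` in `hG`. -/
theorem observability_eq_adjoint_rot_mulPencil (hT : ‖T‖ ≤ 1) {R : H →L[ℂ] H} {w : Circle}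
    (hR : R * T = (w : ℂ)⁻¹ • (T * R)) {G G' : DefectSpace T →L[ℂ] DefectSpace T}
    (hG : ∀ x, toClosedRange (defectOp T) (R x) = G (toClosedRange (defectOp T) x) +
      (w : ℂ) • (G'†) (toClosedRange (defectOp T) (T x))) (x : H) :
    observability hT (R x) =
      ((Hardy.rot w⁻¹ ∘L Hardy.mulPencil (G†) G')†) (observability hT x) := by
  refine lp.ext (funext fun n => ?_)
  rw [observability_twisted_apply hT (G' := (w : ℂ) • G'†) (inv_ne_zero (Circle.coe_ne_zero w)) hR
    hG, Hardy.adjoint_rot_mulPencil_apply, inv_inv, ContinuousLinearMap.adjoint_adjoint, smul_add,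
    smul_apply, smul_smul, pow_succ]

theorem observability_backShift (hT : ‖T‖ ≤ 1) (x : H) :
    observability hT (T x) = Hardy.backShift (observability hT x) := by
  refine lp.ext (funext fun n => ?_)
  rw [Hardy.backShift_apply, observability_apply, observability_apply, pow_succ, mul_apply_eq_comp]

/-- The partial sums telescope to `‖x‖² - ‖Tⁿ x‖²`, and `‖Tⁿ x‖²` tends to `‖Q_T x‖²`. -/
theorem norm_sq_observability (hT : ‖T‖ ≤ 1) (x : H) :
    ‖observability hT x‖ ^ 2 = ‖x‖ ^ 2 - ‖asymptoticRoot hT x‖ ^ 2 := by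
  rw [Hardy.norm_sq]
  refine tendsto_nhds_unique (Hardy.summable_sq (observability hT x)).hasSum.tendsto_sum_nat ?_
  refine ((tendsto_norm_sq hT x).const_sub (‖x‖ ^ 2)).congr fun n => ?_
  rw [← sum_norm_defectOp_sq hT]
  rfl

theorem inner_observability (hT : ‖T‖ ≤ 1) (x : H) (f : Hardy (DefectSpace T)) :
    inner ℂ (observability hT x) f = inner ℂ (toClosedRange (defectOp T) x) (f 0) +
      inner ℂ (observability hT (T x)) (Hardy.backShift f) := by
  rw [observability_backShift, lp.inner_eq_tsum, lp.inner_eq_tsum,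
    (lp.summable_inner (𝕜 := ℂ) (observability hT x) f).tsum_eq_zero_add]
  rfl

variable {L : Type*} [NormedAddCommGroup L] [InnerProductSpace ℂ L] [CompleteSpace L]

theorem blockDiag_backShift_pow_apply {E : Type*} [NormedAddCommGroup E] [InnerProductSpace ℂ E]
    (U : L →L[ℂ] L) (n : ℕ) (f : Hardy E) (z : L) :
    (blockDiag Hardy.backShift U ^ n) (WithLp.toLp 2 (f, z)) =
      WithLp.toLp 2 ((Hardy.backShift ^ n) f, (U ^ n) z) := by
  induction n with
  | zero => rfl
  | succ n ih =>
    rw [pow_succ', mul_apply_eq_comp, ih, blockDiag_apply, pow_succ', mul_apply_eq_comp, pow_succ',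
      mul_apply_eq_comp]

theorem Hardy.backShift_pow_apply {E : Type*} [NormedAddCommGroup E] [InnerProductSpace ℂ E]
    (n k : ℕ) (f : Hardy E) : (Hardy.backShift ^ n) f k = f (k + n) := by
  induction n generalizing k with
  | zero => rfl
  | succ n ih =>
    rw [pow_succ', mul_apply_eq_comp, Hardy.backShift_apply, ih,
      show k + 1 + n = k + (n + 1) by omega]

/-- The embedding `x ↦ (𝒪 x, e x)` is cyclic for `M_z ⊕ U*` when `e` is cyclic for `U*` and
intertwines `T` with the isometry `U`. -/
theorem observability_minimal (hT : ‖T‖ ≤ 1) {e : H → L} {U : L →L[ℂ] L} (hU : U† * U = 1)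
    (he : ∀ x, e (T x) = U (e x))
    (hmin : ∀ z, (∀ n x, inner ℂ (e x) ((U ^ n) z) = 0) → z = 0) :
    (Submodule.span ℂ {y : WithLp 2 (Hardy (DefectSpace T) × L) | ∃ (n : ℕ) (x : H),
      (blockDiag Hardy.shift (U†) ^ n) (WithLp.toLp 2 (observability hT x, e x)) =
        y}).topologicalClosure = ⊤ := by
  have h0 : blockDiag Hardy.shift (U†) =
      (blockDiag (Hardy.backShift : Hardy (DefectSpace T) →L[ℂ] _) U)† := by
    rw [adjoint_blockDiag, ← Hardy.adjoint_shift, ContinuousLinearMap.adjoint_adjoint]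
  rw [h0]
  refine minimal_of_inner_eq_zero fun y hy => ?_
  obtain ⟨⟨f, z⟩⟩ := y
  have h1 : ∀ n x, inner ℂ (observability hT x) ((Hardy.backShift ^ n) f) +
      inner ℂ (e x) ((U ^ n) z) = 0 := fun n x => by
    have h2 := hy n x
    rwa [blockDiag_backShift_pow_apply, WithLp.prod_inner_apply] at h2
  have h3 : ∀ n, f n = 0 := fun n => eq_zero_of_inner_toClosedRange fun x => by
    -- Since `U` is isometric and `e (T x) = U (e x)`, orthogonality at `(n + 1, T x)` and at `(n,
    -- x)` has the same second term. Their difference isolates the pairing of `D_T x` with the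
    -- coefficient `f n`.
    have h4 := h1 (n + 1) (T x)
    have h5 := h1 n x
    have h6 : inner ℂ (e (T x)) ((U ^ (n + 1)) z) = inner ℂ (e x) ((U ^ n) z) := by
      rw [he, pow_succ', mul_apply_eq_comp, ← ContinuousLinearMap.adjoint_inner_right,
        ← mul_apply_eq_comp (U†), hU, one_apply_eq_self]
    rw [h6, pow_succ', mul_apply_eq_comp] at h4
    rw [inner_observability, Hardy.backShift_pow_apply, zero_add, add_assoc, h4, add_zero] at h5
    exact h5
  have hf : f = 0 := lp.ext (funext h3)
  have hz : z = 0 := hmin z fun n x => by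
    have h2 := h1 n x
    rwa [hf, map_zero, inner_zero_right, zero_add] at h2
  rw [hf, hz]
  rfl

end Observability

theorem toLp_eq_adjoint_blockDiag {K L : Type*} [NormedAddCommGroup K] [InnerProductSpace ℂ K]
    [CompleteSpace K] [NormedAddCommGroup L] [InnerProductSpace ℂ L] [CompleteSpace L]
    {A : K →L[ℂ] K} {B : L →L[ℂ] L} {x x' : K} {y y' : L} (hx : x' = (A†) x) (hy : y' = (B†) y) :
    WithLp.toLp 2 (x', y') = ((blockDiag A B)†) (WithLp.toLp 2 (x, y)) := by
  rw [adjoint_blockDiag, blockDiag_apply, hx, hy]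

/-! ### The Douglas model as a pseudo lift. -/

section Douglas

variable {H : Type*} [NormedAddCommGroup H] [InnerProductSpace ℂ H] [CompleteSpace H]
  {q : Circle} {T₁ T₂ : H →L[ℂ] H} {h : IsQCommutingContractivePair q T₁ T₂}
  {𝒬 : Type*} [NormedAddCommGroup 𝒬] [InnerProductSpace ℂ 𝒬] [CompleteSpace 𝒬]

theorem isCanonicalUnitaryPair (M : MinimalUnitaryExtension (adjX h) 𝒬) :
    IsCanonicalUnitaryPair M (canonicalUnitaryPair M) :=
  (existsUnique_canonicalUnitaryPair M).choose_spec.1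

section CanonicalPair

variable {M : MinimalUnitaryExtension (adjX h) 𝒬} {W : (𝒬 →L[ℂ] 𝒬) × (𝒬 →L[ℂ] 𝒬)}

theorem norm_apply_of_mem_unitary {A : 𝒬 →L[ℂ] 𝒬} (hA : A ∈ unitary (𝒬 →L[ℂ] 𝒬)) (y : 𝒬) :
    ‖A y‖ = ‖y‖ :=
  (ContinuousLinearMap.norm_map_iff_adjoint_comp_self A).2 (Unitary.mem_iff.1 hA).1 y

theorem IsCanonicalUnitaryPair.comm_left (hW : IsCanonicalUnitaryPair M W) :
    W.1 * unitaryD M = (q : ℂ) • (unitaryD M * W.1) := by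
  rw [← hW.prod]
  -- Only the product inside `W₁(W₁W₂)` is exchanged; both sides then agree up to associativity.
  nth_rw 1 [hW.comm]
  rw [mul_smul_comm, mul_assoc]

theorem IsCanonicalUnitaryPair.comm_right (hW : IsCanonicalUnitaryPair M W) :
    W.2 * unitaryD M = (starRingEnd ℂ) (q : ℂ) • (unitaryD M * W.2) := by
  have h1 : unitaryD M * W.2 = (q : ℂ) • (W.2 * unitaryD M) := by
    rw [← hW.prod]
    nth_rw 1 [hW.comm]
    rw [smul_mul_assoc, mul_assoc]
  rw [h1, smul_smul, conj_mul_circle, one_smul]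

/-- Because `W₂` is unitary, `W₂*W_D = W₂*(qW₂W₁) = qW₁`. -/
theorem IsCanonicalUnitaryPair.eq_left (hW : IsCanonicalUnitaryPair M W) :
    W.1 = (starRingEnd ℂ) (q : ℂ) • (W.2† * unitaryD M) := by
  have h1 : W.2† * W.2 = 1 := (Unitary.mem_iff.1 hW.unitary₂).1
  rw [← hW.prod, hW.comm, mul_smul_comm, ← mul_assoc, h1, one_mul, smul_smul, conj_mul_circle,
    one_smul]

theorem IsCanonicalUnitaryPair.isPseudoTriple (hW : IsCanonicalUnitaryPair M W) :
    IsPseudoTriple q W.1 W.2 (unitaryD M) where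
  norm_left := ContinuousLinearMap.opNorm_le_bound _ zero_le_one fun y => by
    rw [one_mul, norm_apply_of_mem_unitary hW.unitary₁]
  norm_right := ContinuousLinearMap.opNorm_le_bound _ zero_le_one fun y => by
    rw [one_mul, norm_apply_of_mem_unitary hW.unitary₂]
  isometry := norm_apply_of_mem_unitary (Unitary.star_mem M.unitary)
  comm_left := hW.comm_left
  comm_right := hW.comm_right
  eq_left := hW.eq_left

end CanonicalPair

theorem observability_left (h : IsQCommutingContractivePair q T₁ T₂) (x : H) :
    observability h.norm_adj ((T₁†) x) =
      ((Hardy.mulPencil ((fundamentalOps h).1†) (fundamentalOps h).2 ∘L Hardy.rot q)†)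
        (observability h.norm_adj x) :=
  observability_eq_adjoint_mulPencil_rot h.norm_adj h.adj_comm_left (defect_adjoint_left h) x

theorem observability_right (h : IsQCommutingContractivePair q T₁ T₂) (x : H) :
    observability h.norm_adj ((T₂†) x) =
      ((Hardy.rot q⁻¹ ∘L Hardy.mulPencil ((fundamentalOps h).2†) (fundamentalOps h).1)†)
        (observability h.norm_adj x) :=
  observability_eq_adjoint_rot_mulPencil h.norm_adj h.adj_comm_right (defect_adjoint_right h) x

variable (M : MinimalUnitaryExtension (adjX h) 𝒬)

theorem norm_douglasEmb (x : H) : ‖douglasEmb M x‖ = ‖x‖ := by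
  refine (sq_eq_sq₀ (norm_nonneg _) (norm_nonneg _)).1 ?_
  refine (WithLp.prod_norm_sq_eq_of_L2 _).trans ?_
  change ‖observability h.norm_adj x‖ ^ 2 +
    ‖M.emb (toClosedRange (asymptoticRoot h.norm_adj) x)‖ ^ 2 = _
  rw [norm_sq_observability, LinearIsometry.norm_map]
  exact sub_add_cancel _ _

theorem isPseudoTriple_douglas : IsPseudoTriple q (douglasW₁ M) (douglasW₂ M) (douglasV M) :=
  (Hardy.isPseudoTriple_mulPencil (norm_mulPencil_fundamentalOps_left_le h)
    (norm_mulPencil_fundamentalOps_right_le h)).blockDiag (isCanonicalUnitaryPair M).isPseudoTriple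

/-- Minimality of the extension, tested only on the dense set `Q_{T*} H`; this is the cyclicity that
`observability_minimal` asks of the second summand. -/
theorem MinimalUnitaryExtension.eq_zero_of_inner {z : 𝒬}
    (hz : ∀ n x, inner ℂ (M.emb (toClosedRange (asymptoticRoot h.norm_adj) x)) ((M.U ^ n) z) = 0) :
    z = 0 := by
  refine eq_zero_of_inner_minimal (W := M.U†) (Φ := M.emb.toContinuousLinearMap)
    M.minimal fun n y => ?_
  have h1 : M.U† ^ n = (M.U ^ n)† := (star_pow _ n).symm
  rw [h1, ContinuousLinearMap.adjoint_inner_left]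
  exact (denseRange_toClosedRange (asymptoticRoot h.norm_adj)).induction_on y
    (isClosed_eq (by fun_prop) (by fun_prop)) (hz n)

theorem emb_toClosedRange_adjoint (x : H) :
    M.emb (toClosedRange (asymptoticRoot h.norm_adj) (((T₁ * T₂)†) x)) =
      M.U (M.emb (toClosedRange (asymptoticRoot h.norm_adj) x)) := by
  rw [M.extends_op, adjX_apply]

theorem isPseudoLift_douglas :
    IsPseudoLift q T₁ T₂ (douglasEmb M) (douglasW₁ M) (douglasW₂ M) (douglasV M) where
  triple := isPseudoTriple_douglas M
  isometry := norm_douglasEmb M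
  intertwine₁ := ContinuousLinearMap.ext fun x =>
    toLp_eq_adjoint_blockDiag (observability_left h x)
      (((isCanonicalUnitaryPair M).extends₁ _).trans (congrArg M.emb (adjX₁_apply h x))).symm
  intertwine₂ := ContinuousLinearMap.ext fun x =>
    toLp_eq_adjoint_blockDiag (observability_right h x)
      (((isCanonicalUnitaryPair M).extends₂ _).trans (congrArg M.emb (adjX₂_apply h x))).symm
  intertwine := by
    change douglasEmb M ∘L (T₂† * T₁†) = _
    rw [← h.adj_eq]
    refine ContinuousLinearMap.ext fun x => toLp_eq_adjoint_blockDiag ?_ ?_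
    · rw [Hardy.adjoint_shift]
      exact observability_backShift h.norm_adj x
    -- The adjoint of `W_D` is `M.U`, which extends `X*`.
    · rw [unitaryD, ContinuousLinearMap.adjoint_adjoint]
      exact emb_toClosedRange_adjoint M x
  minimal := observability_minimal h.norm_adj M.U_adjoint_mul (emb_toClosedRange_adjoint M)
    fun _ => M.eq_zero_of_inner

end Douglas

end TwistedPair

theorem theoremD {H : Type*} [NormedAddCommGroup H] [InnerProductSpace ℂ H] [CompleteSpace H]
    (q : Circle) (T₁ T₂ : H →L[ℂ] H) (h : IsQCommutingContractivePair q T₁ T₂)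
    {𝒬 : Type*} [NormedAddCommGroup 𝒬] [InnerProductSpace ℂ 𝒬] [CompleteSpace 𝒬]
    (M : MinimalUnitaryExtension (adjX h) 𝒬) :
    IsPseudoLift q T₁ T₂ (douglasEmb M) (douglasW₁ M) (douglasW₂ M) (douglasV M) ∧
      ∀ W₁ W₂ : DouglasSpace T₁ T₂ 𝒬 →L[ℂ] DouglasSpace T₁ T₂ 𝒬,
        IsPseudoLift q T₁ T₂ (douglasEmb M) W₁ W₂ (douglasV M) →
          W₁ = douglasW₁ M ∧ W₂ = douglasW₂ M :=
  ⟨isPseudoLift_douglas M, fun _ _ hW => hW.unique (isPseudoLift_douglas M)⟩
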